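/- Write $Q=(0,1)^2$, and let $|\cdot|$ be the Euclidean norm on vectors and the Frobenius norm on matrices, with $\operatorname{dist}$ the corresponding distance. For $u\in W^{1,2}(Q;\mathbb R^2)$ let $e(u)=\frac12(\nabla u+(\nabla u)^t)$, and let $|D^2u|(Q)\in[0,\infty]$ be the total variation of the distributional derivative of $\nabla u$ (equal to $\infty$ if this derivative is not a finite measure). For an interval $I\subset(0,1)$ let $$\operatorname{osc}_{\{0\}\times I}(u)=\operatorname*{ess\,sup}_{y_1,y_2\in I}|u(0,y_1)-u(0,y_2)|,$$ where $u(0,\cdot)$ denotes the trace of $u$ on the side $\{0\}\times(0,1)$. 1. (Geometrically nonlinear setting.) Let $\mathcal K\subset\mathbb R^{2\times2}$ be nonempty and compact with $$d:=\min_{K\in\mathcal K}|Ke_2-e_2|>0 .$$ Then there exists a constant $c>0$, depending only on $d$ and $\mathcal K$, such that for all $u\in W^{1,2}(Q;\mathbb R^2)$ with $$\operatorname{osc}_{\{0\}\times I}(u-\mathrm{id})\le \frac{d}{104}|I|\quad\text{for every open interval } I\subset(0,1)$$ and all $\epsilon>0$, $$E_\epsilon(u):=\int_{Q}\operatorname{dist}^2(\nabla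 u,\mathcal K)\,dx+\epsilon|D^2u|(Q)\ \ge\ c\min\{1,\epsilon(|\log\epsilon|+1)\}.$$ 2. (Geometrically linear setting.) Let $\tilde{\mathcal K}\subset\mathbb R^{2\times2}_{sym}$ be a nonempty compact set of symmetric matrices with $$d:=\min_{\tilde K\in\tilde{\mathcal K}}|\tilde K_{22}|>0 .$$ Then there exists a constant $c>0$, depending only on $d$ and $\tilde{\mathcal K}$, such that for all $u\in W^{1,2}(Q;\mathbb R^2)$ with $$\operatorname{osc}_{\{0\}\times I}(u)\le \frac{d}{104}|I|\quad\text{for every open interval } I\subset(0,1)$$ and all $\epsilon>0$, $$F_\epsilon(u):=\int_{Q}\operatorname{dist}^2(e(u),\tilde{\mathcal K})\,dx+\epsilon|D^2u|(Q)\ \ge\ c\min\{1,\epsilon(|\log\epsilon|+1)\}.$$ -/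

import Mathlib

open MeasureTheory Set Filter Topology
open scoped ENNReal ContDiff

noncomputable section

/-- Vectors in the plane with the Euclidean norm (values of the deformations and displacements).
The reference configuration itself is taken inside `ℝ × ℝ` with Lebesgue measure. -/
abbrev Vec2 : Type := EuclideanSpace ℝ (Fin 2)

/-- Real `2 × 2` matrices. -/
abbrev Mat2 : Type := Matrix (Fin 2) (Fin 2) ℝ

/-- The open unit square `(0,1)²`. -/
def unitSquare : Set (ℝ × ℝ) := Ioo 0 1 ×ˢ Ioo 0 1

/-- The partial derivative `∂ⱼ φ` of a scalar function on the plane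
(`j = 0` is the first variable, `j = 1` the second). -/
def partialD (j : Fin 2) (φ : ℝ × ℝ → ℝ) (x : ℝ × ℝ) : ℝ :=
  fderiv ℝ φ x ((![(1, 0), (0, 1)] : Fin 2 → ℝ × ℝ) j)

/-- `G` is a square integrable weak gradient of `u` on the unit square, with `G i j = ∂ⱼ uᵢ`. -/
structure IsL2WeakGradient (u : ℝ × ℝ → Vec2) (G : ℝ × ℝ → Mat2) : Prop where
  memLp : ∀ i j, MemLp (fun x => G x i j) 2 (volume.restrict unitSquare)
  integral_eq : ∀ φ : ℝ × ℝ → ℝ, ContDiff ℝ ∞ φ → HasCompactSupport φ →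
    tsupport φ ⊆ unitSquare → ∀ i j,
      ∫ x in unitSquare, u x i * partialD j φ x = - ∫ x in unitSquare, G x i j * φ x

/-- `u ∈ W^{1,2}((0,1)²; ℝ²)`. -/
def MemW12 (u : ℝ × ℝ → Vec2) : Prop :=
  MemLp u 2 (volume.restrict unitSquare) ∧ ∃ G, IsL2WeakGradient u G

open Classical in
/-- The weak gradient `∇u` on the unit square (determined almost everywhere); the value `0` is
used only for functions without a square integrable weak gradient. -/
def weakGrad (u : ℝ × ℝ → Vec2) : ℝ × ℝ → Mat2 :=
  if h : ∃ G, IsL2WeakGradient u G then h.choose else 0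

theorem MemW12.isL2WeakGradient {u : ℝ × ℝ → Vec2} (hu : MemW12 u) :
    IsL2WeakGradient u (weakGrad u) := by
  unfold weakGrad
  rw [dif_pos hu.2]
  exact hu.2.choose_spec

/-- `T` is the trace on the side `{0} × (0,1)`, parametrised by `y ∈ (0,1)`, of the function
`u ∈ W^{1,2}((0,1)²; ℝ²)`. The trace operator is the continuous extension to `W^{1,2}` of the
restriction map on functions that are `C¹` up to the boundary: `T` is the `L²` limit of the
restrictions of `C¹` functions which converge to `u` in `W^{1,2}`. -/
def IsLeftTrace (u : ℝ × ℝ → Vec2) (T : ℝ → Vec2) : Prop :=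
  MemLp T 2 (volume.restrict (Ioo 0 1)) ∧
  ∃ w : ℕ → ℝ × ℝ → Vec2, (∀ n, ContDiff ℝ 1 (w n)) ∧
    Tendsto (fun n => eLpNorm (fun x => w n x - u x) 2 (volume.restrict unitSquare))
      atTop (𝓝 0) ∧
    (∀ i j, Tendsto (fun n => eLpNorm
        (fun x => partialD j (fun z => w n z i) x - weakGrad u x i j) 2
        (volume.restrict unitSquare)) atTop (𝓝 0)) ∧
    Tendsto (fun n => eLpNorm (fun y => w n (0, y) - T y) 2 (volume.restrict (Ioo 0 1)))
      atTop (𝓝 0)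

/-- The essential oscillation `ess sup_{y₁, y₂ ∈ I} |g(y₁) - g(y₂)|`. -/
def essOsc (g : ℝ → Vec2) (I : Set ℝ) : ℝ≥0∞ :=
  essSup (fun p : ℝ × ℝ => ‖g p.1 - g p.2‖ₑ) ((volume.restrict I).prod (volume.restrict I))

/-- The total variation on the unit square of the distributional derivative of the matrix field
`G`, with the Euclidean norm on third order tensors; it is `∞` if `G` is not of bounded
variation. For `G = ∇u` this is `|D²u|((0,1)²)`. -/
def totalVar (G : ℝ × ℝ → Mat2) : ℝ≥0∞ :=
  ⨆ (Φ : Fin 2 → Fin 2 → Fin 2 → ℝ × ℝ → ℝ)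
    (_ : ∀ i j k, ContDiff ℝ 1 (Φ i j k) ∧ HasCompactSupport (Φ i j k) ∧
      tsupport (Φ i j k) ⊆ unitSquare)
    (_ : ∀ x, ∑ i, ∑ j, ∑ k, (Φ i j k x) ^ 2 ≤ 1),
    ENNReal.ofReal (∫ x in unitSquare, ∑ i, ∑ j, ∑ k, G x i j * partialD k (Φ i j k) x)

section Frobenius

attribute [local instance] Matrix.frobeniusNormedAddCommGroup

/-- The distance of a matrix to a set of matrices in the Frobenius norm. -/
def distWells (A : Mat2) (𝒦 : Set Mat2) : ℝ := Metric.infDist A 𝒦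

end Frobenius

/-- The geometrically nonlinear energy
`E_ε(u) = ∫ dist²(∇u, 𝒦) dx + ε |D²u|((0,1)²)`, with values in `[0,∞]`. -/
def nonlinearEnergy (𝒦 : Set Mat2) (ε : ℝ) (u : ℝ × ℝ → Vec2) : ℝ≥0∞ :=
  (∫⁻ x in unitSquare, ENNReal.ofReal (distWells (weakGrad u x) 𝒦 ^ 2)) +
    ENNReal.ofReal ε * totalVar (weakGrad u)

/-- The infinitesimal strain `e(u) = (∇u + (∇u)ᵗ) / 2`. -/
def strain (u : ℝ × ℝ → Vec2) (x : ℝ × ℝ) : Mat2 :=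
  (1 / 2 : ℝ) • (weakGrad u x + (weakGrad u x).transpose)

/-- The geometrically linear energy
`F_ε(u) = ∫ dist²(e(u), 𝒦) dx + ε |D²u|((0,1)²)`, with values in `[0,∞]`. -/
def linearEnergy (𝒦 : Set Mat2) (ε : ℝ) (u : ℝ × ℝ → Vec2) : ℝ≥0∞ :=
  (∫⁻ x in unitSquare, ENNReal.ofReal (distWells (strain u x) 𝒦 ^ 2)) +
    ENNReal.ofReal ε * totalVar (weakGrad u)

/-- The second standard basis vector `e₂`. -/
def e2 : Vec2 := !₂[0, 1]

/-- The matrix-vector product `A v`. -/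
def mulVec2 (A : Mat2) (v : Vec2) : Vec2 := WithLp.toLp 2 (A.mulVec v.ofLp)

end

theorem hasDerivAt_slice_fst {φ : ℝ × ℝ → ℝ} {s y : ℝ} (h : DifferentiableAt ℝ φ (s, y)) :
    HasDerivAt (fun r => φ (r, y)) (partialD 0 φ (s, y)) s :=
  h.hasFDerivAt.comp_hasDerivAt s ((hasDerivAt_id s).prodMk (hasDerivAt_const s y))

theorem hasDerivAt_slice_snd {φ : ℝ × ℝ → ℝ} {s y : ℝ} (h : DifferentiableAt ℝ φ (s, y)) :
    HasDerivAt (fun z => φ (s, z)) (partialD 1 φ (s, y)) y :=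
  h.hasFDerivAt.comp_hasDerivAt y ((hasDerivAt_const y s).prodMk (hasDerivAt_id y))

theorem continuous_partialD {φ : ℝ × ℝ → ℝ} (h : ContDiff ℝ 1 φ) (j : Fin 2) :
    Continuous (partialD j φ) :=
  (h.continuous_fderiv one_ne_zero).clm_apply continuous_const

theorem contDiff_partialD {φ : ℝ × ℝ → ℝ} (h : ContDiff ℝ ∞ φ) (j : Fin 2) :
    ContDiff ℝ ∞ (partialD j φ) :=
  (h.fderiv_right (m := ∞) le_rfl).clm_apply contDiff_const

theorem partialD_mul {φ ψ : ℝ × ℝ → ℝ} {x : ℝ × ℝ} (hφ : DifferentiableAt ℝ φ x)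
    (hψ : DifferentiableAt ℝ ψ x) (j : Fin 2) :
    partialD j (fun z => φ z * ψ z) x = φ x * partialD j ψ x + ψ x * partialD j φ x := by
  simp [partialD, fderiv_fun_mul hφ hψ]

theorem partialD_eq_zero_of_notMem_tsupport {φ : ℝ × ℝ → ℝ} {x : ℝ × ℝ} (j : Fin 2)
    (h : x ∉ tsupport φ) : partialD j φ x = 0 := by
  rw [partialD, fderiv_of_notMem_tsupport ℝ h]; rfl

theorem tsupport_partialD_subset (φ : ℝ × ℝ → ℝ) (j : Fin 2) :
    tsupport (partialD j φ) ⊆ tsupport φ := by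
  refine closure_minimal (fun x hx => ?_) (isClosed_tsupport φ)
  by_contra h
  exact hx (partialD_eq_zero_of_notMem_tsupport j h)

/-! ### Integrals over `(0,1)` depending on a parameter -/

theorem hasFDerivAt_unitIntegral {F : (ℝ × ℝ) × ℝ → ℝ} (hF : ContDiff ℝ 1 F) (p : ℝ × ℝ) :
    HasFDerivAt (fun q => ∫ r in (0:ℝ)..1, F (q, r))
      (∫ r in (0:ℝ)..1, (fderiv ℝ F (p, r)).comp (ContinuousLinearMap.inl ℝ (ℝ × ℝ) ℝ)) p := by
  have hc : Continuous fun z : (ℝ × ℝ) × ℝ =>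
      (fderiv ℝ F z).comp (ContinuousLinearMap.inl ℝ (ℝ × ℝ) ℝ) :=
    (hF.continuous_fderiv one_ne_zero).clm_comp continuous_const
  obtain ⟨C, hC⟩ := ((isCompact_closedBall p 1).prod (isCompact_Icc (a := (0:ℝ)) (b := 1))).exists_bound_of_continuousOn
    hc.continuousOn
  refine intervalIntegral.hasFDerivAt_integral_of_dominated_of_fderiv_le
    (F' := fun q r => (fderiv ℝ F (q, r)).comp (ContinuousLinearMap.inl ℝ (ℝ × ℝ) ℝ))
    (bound := fun _ => C) (Metric.closedBall_mem_nhds p one_pos) ?_ ?_ ?_ ?_ ?_ ?_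
  · exact Eventually.of_forall fun q =>
      (hF.continuous.comp (Continuous.prodMk_right q)).aestronglyMeasurable
  · exact (hF.continuous.comp (Continuous.prodMk_right p)).intervalIntegrable _ _
  · exact (hc.comp (Continuous.prodMk_right p)).aestronglyMeasurable
  · refine Eventually.of_forall fun t ht q hq => hC (q, t) ⟨hq, ?_⟩
    rw [uIoc_of_le zero_le_one] at ht
    exact ⟨ht.1.le, ht.2⟩
  · exact intervalIntegrable_const
  · refine Eventually.of_forall fun t _ q _ => ?_
    exact ((hF.differentiable one_ne_zero) (q, t)).hasFDerivAt.comp q (hasFDerivAt_prodMk_left q t)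

theorem contDiff_unitIntegral {F : (ℝ × ℝ) × ℝ → ℝ} (hF : ContDiff ℝ 1 F) :
    ContDiff ℝ 1 fun q => ∫ r in (0:ℝ)..1, F (q, r) := by
  have hc : Continuous fun z : (ℝ × ℝ) × ℝ =>
      (fderiv ℝ F z).comp (ContinuousLinearMap.inl ℝ (ℝ × ℝ) ℝ) :=
    (hF.continuous_fderiv one_ne_zero).clm_comp continuous_const
  rw [contDiff_one_iff_hasFDerivAt]
  exact ⟨_, intervalIntegral.continuous_parametric_intervalIntegral_of_continuous'
    (f := fun (p : ℝ × ℝ) r => (fderiv ℝ F (p, r)).comp (ContinuousLinearMap.inl ℝ (ℝ × ℝ) ℝ))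
    hc 0 1, hasFDerivAt_unitIntegral hF⟩

theorem partialD_unitIntegral {F : (ℝ × ℝ) × ℝ → ℝ} (hF : ContDiff ℝ 1 F) (j : Fin 2)
    (p : ℝ × ℝ) :
    partialD j (fun q => ∫ r in (0:ℝ)..1, F (q, r)) p =
      ∫ r in (0:ℝ)..1, partialD j (fun q => F (q, r)) p := by
  have hc : Continuous fun z : (ℝ × ℝ) × ℝ =>
      (fderiv ℝ F z).comp (ContinuousLinearMap.inl ℝ (ℝ × ℝ) ℝ) :=
    (hF.continuous_fderiv one_ne_zero).clm_comp continuous_const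
  unfold partialD
  rw [(hasFDerivAt_unitIntegral hF p).fderiv, ContinuousLinearMap.intervalIntegral_apply]
  · refine intervalIntegral.integral_congr fun r _ => ?_
    have : HasFDerivAt (fun q => F (q, r))
        ((fderiv ℝ F (p, r)).comp (ContinuousLinearMap.inl ℝ (ℝ × ℝ) ℝ)) p :=
      ((hF.differentiable one_ne_zero) (p, r)).hasFDerivAt.comp p (hasFDerivAt_prodMk_left p r)
    exact congrArg (fun A : ℝ × ℝ →L[ℝ] ℝ => A ((![(1, 0), (0, 1)] : Fin 2 → ℝ × ℝ) j)) this.fderiv.symm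
  · exact (hc.comp (Continuous.prodMk_right p)).intervalIntegrable _ _

/-! ### Averages in the second variable over lengths depending on the first -/

/-- The weighted average `∫₀¹ κ(τ) σ(s, y - ℓ(s) τ) dτ`. -/
noncomputable def shiftAverage (κ ℓ : ℝ → ℝ) (σ : ℝ × ℝ → ℝ) (x : ℝ × ℝ) : ℝ :=
  ∫ τ in (0:ℝ)..1, κ τ * σ (x.1, x.2 - ℓ x.1 * τ)

theorem contDiff_shiftAverage_integrand {κ ℓ : ℝ → ℝ} {σ : ℝ × ℝ → ℝ} (hκ : ContDiff ℝ 1 κ)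
    (hℓ : ContDiff ℝ 1 ℓ) (hσ : ContDiff ℝ 1 σ) :
    ContDiff ℝ 1 fun z : (ℝ × ℝ) × ℝ => κ z.2 * σ (z.1.1, z.1.2 - ℓ z.1.1 * z.2) := by
  fun_prop

theorem contDiff_shiftAverage {κ ℓ : ℝ → ℝ} {σ : ℝ × ℝ → ℝ} (hκ : ContDiff ℝ 1 κ)
    (hℓ : ContDiff ℝ 1 ℓ) (hσ : ContDiff ℝ 1 σ) : ContDiff ℝ 1 (shiftAverage κ ℓ σ) :=
  contDiff_unitIntegral (contDiff_shiftAverage_integrand hκ hℓ hσ)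

theorem partialD_one_shiftAverage {κ ℓ : ℝ → ℝ} {σ : ℝ × ℝ → ℝ} (hκ : ContDiff ℝ 1 κ)
    (hℓ : ContDiff ℝ 1 ℓ) (hσ : ContDiff ℝ 1 σ) (x : ℝ × ℝ) :
    partialD 1 (shiftAverage κ ℓ σ) x = shiftAverage κ ℓ (partialD 1 σ) x := by
  refine (partialD_unitIntegral (contDiff_shiftAverage_integrand hκ hℓ hσ) 1 x).trans ?_
  refine intervalIntegral.integral_congr fun r _ => ?_
  obtain ⟨s, y⟩ := x
  have h1 : DifferentiableAt ℝ (fun q : ℝ × ℝ => κ r * σ (q.1, q.2 - ℓ q.1 * r)) (s, y) := by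
    have : ContDiff ℝ 1 (fun q : ℝ × ℝ => κ r * σ (q.1, q.2 - ℓ q.1 * r)) := by fun_prop
    exact this.differentiable one_ne_zero _
  have h2 := hasDerivAt_slice_snd (φ := σ) (s := s) (y := y - ℓ s * r)
    (hσ.differentiable one_ne_zero _)
  have h3 : HasDerivAt (fun z => σ (s, z - ℓ s * r)) (partialD 1 σ (s, y - ℓ s * r)) y :=
    HasDerivAt.comp_sub_const y (ℓ s * r) h2
  exact (hasDerivAt_slice_snd h1).unique (h3.const_mul (κ r))

theorem mul_shiftAverage_partialD {κ κ' ℓ : ℝ → ℝ} {σ : ℝ × ℝ → ℝ}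
    (hκ : ∀ τ, HasDerivAt κ (κ' τ) τ) (hκ' : Continuous κ') (hσ : ContDiff ℝ 1 σ) (s y : ℝ) :
    ℓ s * shiftAverage κ ℓ (partialD 1 σ) (s, y) =
      shiftAverage κ' ℓ σ (s, y) + κ 0 * σ (s, y) - κ 1 * σ (s, y - ℓ s) := by
  have hκc : Continuous κ := continuous_iff_continuousAt.2 fun τ => (hκ τ).continuousAt
  have hd : ∀ τ, HasDerivAt (fun τ => κ τ * σ (s, y - ℓ s * τ))
      (κ' τ * σ (s, y - ℓ s * τ) + κ τ * (partialD 1 σ (s, y - ℓ s * τ) * (-(ℓ s)))) τ := by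
    intro τ
    refine (hκ τ).mul ?_
    have h2 := hasDerivAt_slice_snd (φ := σ) (s := s) (y := y - ℓ s * τ)
      (hσ.differentiable one_ne_zero _)
    have h3 : HasDerivAt (fun τ => y - ℓ s * τ) (-(ℓ s)) τ := by
      simpa using ((hasDerivAt_id τ).const_mul (ℓ s)).const_sub y
    exact HasDerivAt.comp τ h2 h3
  have hpc := continuous_partialD hσ 1
  have hσc := hσ.continuous
  have hi := intervalIntegral.integral_eq_sub_of_hasDerivAt (a := 0) (b := 1)
    (fun τ _ => hd τ) (Continuous.intervalIntegrable (by fun_prop) _ _)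
  rw [intervalIntegral.integral_add (Continuous.intervalIntegrable (by fun_prop) _ _)
    (Continuous.intervalIntegrable (by fun_prop) _ _)] at hi
  have h4 : ∫ τ in (0:ℝ)..1, κ τ * (partialD 1 σ (s, y - ℓ s * τ) * (-(ℓ s))) =
      -(ℓ s) * shiftAverage κ ℓ (partialD 1 σ) (s, y) := by
    rw [shiftAverage, ← intervalIntegral.integral_const_mul]
    congr 1; ext τ; ring
  rw [h4] at hi
  simp only [mul_zero, sub_zero, mul_one] at hi
  simp only [shiftAverage] at hi ⊢
  linarith

theorem abs_shiftAverage_le {κ ℓ : ℝ → ℝ} {σ : ℝ × ℝ → ℝ} {c B s : ℝ}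
    (hκ : ∀ τ ∈ Icc (0:ℝ) 1, |κ τ| ≤ c) (hσ : ∀ y, |σ (s, y)| ≤ B) (y : ℝ) :
    |shiftAverage κ ℓ σ (s, y)| ≤ c * B := by
  have := intervalIntegral.norm_integral_le_of_norm_le_const (a := (0:ℝ)) (b := 1)
    (f := fun τ => κ τ * σ (s, y - ℓ s * τ)) (C := c * B) (fun τ hτ => ?_)
  · simpa [shiftAverage] using this
  · rw [uIoc_of_le zero_le_one] at hτ
    have h1 := hκ τ ⟨hτ.1.le, hτ.2⟩
    rw [Real.norm_eq_abs, abs_mul]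
    exact mul_le_mul h1 (hσ _) (abs_nonneg _) ((abs_nonneg _).trans h1)

theorem shiftAverage_eq_zero {κ ℓ : ℝ → ℝ} {σ : ℝ × ℝ → ℝ} {s y : ℝ}
    (h : ∀ τ ∈ Icc (0:ℝ) 1, σ (s, y - ℓ s * τ) = 0) : shiftAverage κ ℓ σ (s, y) = 0 := by
  refine (intervalIntegral.integral_congr (g := fun _ => (0:ℝ)) fun τ hτ => ?_).trans (by simp)
  rw [uIcc_of_le zero_le_one] at hτ
  simp [h τ hτ]

/-! ### Primitives in the first variable -/

/-- The primitive `∫ₜ¹ f(s, y) ds`. -/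
noncomputable def tailPrimitive (f : ℝ × ℝ → ℝ) (x : ℝ × ℝ) : ℝ :=
  ∫ s in x.1..1, f (s, x.2)

theorem tailPrimitive_eq_unitIntegral (f : ℝ × ℝ → ℝ) :
    tailPrimitive f = fun x => ∫ r in (0:ℝ)..1, (1 - x.1) * f (x.1 + (1 - x.1) * r, x.2) := by
  ext ⟨t, y⟩
  have := intervalIntegral.smul_integral_comp_add_mul (a := 0) (b := 1) (fun s => f (s, y)) (1 - t) t
  simp only [smul_eq_mul, mul_zero, add_zero, mul_one, add_sub_cancel] at this
  rw [intervalIntegral.integral_const_mul, this, tailPrimitive]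

theorem contDiff_tailPrimitive {f : ℝ × ℝ → ℝ} (hf : ContDiff ℝ 1 f) :
    ContDiff ℝ 1 (tailPrimitive f) := by
  rw [tailPrimitive_eq_unitIntegral]
  exact contDiff_unitIntegral
    (F := fun z => (1 - z.1.1) * f (z.1.1 + (1 - z.1.1) * z.2, z.1.2)) (by fun_prop)

theorem partialD_one_tailPrimitive {f : ℝ × ℝ → ℝ} (hf : ContDiff ℝ 1 f) :
    partialD 1 (tailPrimitive f) = tailPrimitive (partialD 1 f) := by
  rw [tailPrimitive_eq_unitIntegral, tailPrimitive_eq_unitIntegral]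
  ext ⟨t, y⟩
  refine (partialD_unitIntegral
    (F := fun z => (1 - z.1.1) * f (z.1.1 + (1 - z.1.1) * z.2, z.1.2)) (by fun_prop) 1 _).trans ?_
  refine intervalIntegral.integral_congr fun r _ => ?_
  have h1 : ContDiff ℝ 1 fun q : ℝ × ℝ => (1 - q.1) * f (q.1 + (1 - q.1) * r, q.2) := by fun_prop
  exact (hasDerivAt_slice_snd (h1.differentiable one_ne_zero (t, y))).unique
    ((hasDerivAt_slice_snd (s := t + (1 - t) * r) (y := y)
      (hf.differentiable one_ne_zero _)).const_mul (1 - t))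

theorem partialD_zero_tailPrimitive {f : ℝ × ℝ → ℝ} (hf : ContDiff ℝ 1 f) (x : ℝ × ℝ) :
    partialD 0 (tailPrimitive f) x = - f x := by
  obtain ⟨t, y⟩ := x
  have hc : Continuous fun s => f (s, y) := hf.continuous.comp (Continuous.prodMk_left y)
  have h1 := hasDerivAt_slice_fst ((contDiff_tailPrimitive hf).differentiable one_ne_zero (t, y))
  refine h1.unique ?_
  exact intervalIntegral.integral_hasDerivAt_left (hc.intervalIntegrable _ _)
    (hc.stronglyMeasurableAtFilter _ _) hc.continuousAt

theorem measurableSet_unitSquare : MeasurableSet unitSquare :=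
  measurableSet_Ioo.prod measurableSet_Ioo

theorem volume_unitSquare : volume unitSquare = 1 := by
  simp [unitSquare, Measure.volume_eq_prod]

instance : IsFiniteMeasure (volume.restrict unitSquare) :=
  ⟨by simp [volume_unitSquare]⟩

theorem restrict_unitSquare : (volume.restrict unitSquare : Measure (ℝ × ℝ)) =
    (volume.restrict (Ioo 0 1)).prod (volume.restrict (Ioo 0 1)) := by
  rw [unitSquare, Measure.volume_eq_prod, Measure.prod_restrict]

theorem exists_bound_unitSquare {f : ℝ × ℝ → ℝ} (hf : Continuous f) :
    ∃ C, ∀ x ∈ unitSquare, ‖f x‖ ≤ C := by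
  obtain ⟨C, hC⟩ := ((isCompact_Icc (a := (0:ℝ)) (b := 1)).prod
    (isCompact_Icc (a := (0:ℝ)) (b := 1))).exists_bound_of_continuousOn hf.continuousOn
  exact ⟨C, fun x hx => hC x ⟨Ioo_subset_Icc_self hx.1, Ioo_subset_Icc_self hx.2⟩⟩

theorem Continuous.memLp_unitSquare {f : ℝ × ℝ → ℝ} (hf : Continuous f) (p : ℝ≥0∞) :
    MemLp f p (volume.restrict unitSquare) := by
  obtain ⟨C, hC⟩ := exists_bound_unitSquare hf
  exact MemLp.of_bound hf.aestronglyMeasurable C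
    ((ae_restrict_iff' measurableSet_unitSquare).2 (Eventually.of_forall hC))

theorem Continuous.memLp_unitInterval {f : ℝ → ℝ} (hf : Continuous f) (p : ℝ≥0∞) :
    MemLp f p (volume.restrict (Ioo (0:ℝ) 1)) := by
  obtain ⟨C, hC⟩ := (isCompact_Icc (a := (0:ℝ)) (b := 1)).exists_bound_of_continuousOn
    hf.continuousOn
  exact MemLp.of_bound hf.aestronglyMeasurable C
    ((ae_restrict_iff' measurableSet_Ioo).2
      (Eventually.of_forall fun x hx => hC x (Ioo_subset_Icc_self hx)))

theorem Continuous.integrableOn_unitSquare {f : ℝ × ℝ → ℝ} (hf : Continuous f) :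
    IntegrableOn f unitSquare :=
  memLp_one_iff_integrable.1 (hf.memLp_unitSquare 1)

theorem Continuous.integrableOn_unitInterval {f : ℝ → ℝ} (hf : Continuous f) :
    IntegrableOn f (Ioo (0:ℝ) 1) :=
  memLp_one_iff_integrable.1 (hf.memLp_unitInterval 1)

theorem integral_unitSquare {f : ℝ × ℝ → ℝ} (hf : IntegrableOn f unitSquare) :
    ∫ x in unitSquare, f x = ∫ s in Ioo (0:ℝ) 1, ∫ y in Ioo (0:ℝ) 1, f (s, y) := by
  rw [IntegrableOn, restrict_unitSquare] at hf
  rw [restrict_unitSquare, integral_prod _ hf]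

theorem integral_unitSquare_symm {f : ℝ × ℝ → ℝ} (hf : IntegrableOn f unitSquare) :
    ∫ x in unitSquare, f x = ∫ y in Ioo (0:ℝ) 1, ∫ s in Ioo (0:ℝ) 1, f (s, y) := by
  rw [IntegrableOn, restrict_unitSquare] at hf
  rw [restrict_unitSquare, integral_prod_symm _ hf]

theorem integral_unitInterval_deriv {f f' : ℝ → ℝ} (h : ∀ x, HasDerivAt f (f' x) x)
    (hf' : Continuous f') : ∫ x in Ioo (0:ℝ) 1, f' x = f 1 - f 0 := by
  rw [← integral_Ioc_eq_integral_Ioo, ← intervalIntegral.integral_of_le zero_le_one]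
  exact intervalIntegral.integral_eq_sub_of_hasDerivAt (fun x _ => h x)
    (hf'.intervalIntegrable _ _)

theorem integral_partialD_one_eq_zero {F : ℝ × ℝ → ℝ} (hF : ContDiff ℝ 1 F)
    (h0 : ∀ s, F (s, 0) = 0) (h1 : ∀ s, F (s, 1) = 0) :
    ∫ x in unitSquare, partialD 1 F x = 0 := by
  have hc := continuous_partialD hF 1
  rw [integral_unitSquare hc.integrableOn_unitSquare]
  refine (integral_congr_ae (g := fun _ => (0:ℝ)) (Eventually.of_forall fun s => ?_)).trans
    (by simp)
  have := integral_unitInterval_deriv (f := fun y => F (s, y))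
    (fun y => hasDerivAt_slice_snd (hF.differentiable one_ne_zero (s, y)))
    (hc.comp (Continuous.prodMk_right s))
  simpa [h0, h1] using this

theorem integral_partialD_zero_eq {F : ℝ × ℝ → ℝ} (hF : ContDiff ℝ 1 F)
    (h1 : ∀ y, F (1, y) = 0) :
    ∫ x in unitSquare, partialD 0 F x = - ∫ y in Ioo (0:ℝ) 1, F (0, y) := by
  have hc := continuous_partialD hF 0
  rw [integral_unitSquare_symm hc.integrableOn_unitSquare, ← integral_neg]
  refine integral_congr_ae (Eventually.of_forall fun y => ?_)
  have := integral_unitInterval_deriv (f := fun s => F (s, y))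
    (fun s => hasDerivAt_slice_fst (hF.differentiable one_ne_zero (s, y)))
    (hc.comp (Continuous.prodMk_left y))
  simpa [h1] using this

/-- `g₀` and `g₁` are the weak partial derivatives of `f` on the unit square and `τ` is its trace on
the left side, in the sense of integration by parts against functions that need not vanish on the
left side. -/
structure HasTracedGradient (f g₀ g₁ : ℝ × ℝ → ℝ) (τ : ℝ → ℝ) : Prop where
  memLp : MemLp f 2 (volume.restrict unitSquare)
  memLp_zero : MemLp g₀ 2 (volume.restrict unitSquare)
  memLp_one : MemLp g₁ 2 (volume.restrict unitSquare)
  memLp_trace : MemLp τ 2 (volume.restrict (Ioo 0 1))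
  integral_zero : ∀ Z : ℝ × ℝ → ℝ, ContDiff ℝ 1 Z → (∀ y, Z (1, y) = 0) →
    ∫ x in unitSquare, g₀ x * Z x =
      -(∫ x in unitSquare, f x * partialD 0 Z x) - ∫ y in Ioo (0:ℝ) 1, τ y * Z (0, y)
  integral_one : ∀ Z : ℝ × ℝ → ℝ, ContDiff ℝ 1 Z → (∀ s, Z (s, 0) = 0) → (∀ s, Z (s, 1) = 0) →
    ∫ x in unitSquare, g₁ x * Z x = -(∫ x in unitSquare, f x * partialD 1 Z x)

theorem HasTracedGradient.of_contDiff {w : ℝ × ℝ → ℝ} (hw : ContDiff ℝ 1 w) :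
    HasTracedGradient w (partialD 0 w) (partialD 1 w) fun y => w (0, y) where
  memLp := hw.continuous.memLp_unitSquare 2
  memLp_zero := (continuous_partialD hw 0).memLp_unitSquare 2
  memLp_one := (continuous_partialD hw 1).memLp_unitSquare 2
  memLp_trace := (hw.continuous.comp (Continuous.prodMk_right 0)).memLp_unitInterval 2
  integral_zero Z hZ h1 := by
    have hd := continuous_partialD hw 0
    have hd' := continuous_partialD hZ 0
    have h := integral_partialD_zero_eq (hw.mul hZ) (by simp [h1])
    have h2 : ∫ x in unitSquare, partialD 0 (fun z => w z * Z z) x =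
        ∫ x in unitSquare, (w x * partialD 0 Z x + partialD 0 w x * Z x) := by
      refine integral_congr_ae (Eventually.of_forall fun x => ?_)
      have := partialD_mul (hw.differentiable one_ne_zero x) (hZ.differentiable one_ne_zero x) 0
      simp only [mul_comm (Z x)] at this
      exact this
    have i1 : IntegrableOn (fun x => w x * partialD 0 Z x) unitSquare :=
      (hw.continuous.mul hd').integrableOn_unitSquare
    have i2 : IntegrableOn (fun x => partialD 0 w x * Z x) unitSquare :=
      (hd.mul hZ.continuous).integrableOn_unitSquare
    rw [h2, integral_add i1 i2] at h
    linarith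
  integral_one Z hZ h0 h1 := by
    have hd := continuous_partialD hw 1
    have hd' := continuous_partialD hZ 1
    have h := integral_partialD_one_eq_zero (hw.mul hZ) (by simp [h0]) (by simp [h1])
    have h2 : ∫ x in unitSquare, partialD 1 (fun z => w z * Z z) x =
        ∫ x in unitSquare, (w x * partialD 1 Z x + partialD 1 w x * Z x) := by
      refine integral_congr_ae (Eventually.of_forall fun x => ?_)
      have := partialD_mul (hw.differentiable one_ne_zero x) (hZ.differentiable one_ne_zero x) 1
      simp only [mul_comm (Z x)] at this
      exact this
    have i1 : IntegrableOn (fun x => w x * partialD 1 Z x) unitSquare :=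
      (hw.continuous.mul hd').integrableOn_unitSquare
    have i2 : IntegrableOn (fun x => partialD 1 w x * Z x) unitSquare :=
      (hd.mul hZ.continuous).integrableOn_unitSquare
    rw [h2, integral_add i1 i2] at h
    linarith

theorem tendsto_integral_mul_of_eLpNorm {α : Type*} [MeasurableSpace α] {μ : Measure α}
    {A : ℕ → α → ℝ} {B ψ : α → ℝ} (hA : ∀ n, MemLp (A n) 2 μ) (hB : MemLp B 2 μ)
    (hψ : MemLp ψ 2 μ) (h : Tendsto (fun n => eLpNorm (fun x => A n x - B x) 2 μ) atTop (𝓝 0)) :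
    Tendsto (fun n => ∫ x, A n x * ψ x ∂μ) atTop (𝓝 (∫ x, B x * ψ x ∂μ)) := by
  refine tendsto_integral_of_L1' _ (hB.integrable_mul hψ).1
    (Eventually.of_forall fun n => (hA n).integrable_mul hψ) ?_
  have hle : ∀ n, eLpNorm ((fun x => A n x * ψ x) - fun x => B x * ψ x) 1 μ ≤
      eLpNorm (fun x => A n x - B x) 2 μ * eLpNorm ψ 2 μ := by
    intro n
    have := eLpNorm_smul_le_mul_eLpNorm (p := 2) (q := 2) (r := 1) hψ.1 ((hA n).sub hB).1
    refine le_trans (le_of_eq ?_) this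
    congr 1
    ext x
    simp [sub_mul]
  have h0 : Tendsto (fun n => eLpNorm (fun x => A n x - B x) 2 μ * eLpNorm ψ 2 μ) atTop
      (𝓝 0) := by
    simpa using ENNReal.Tendsto.mul_const h (Or.inr hψ.2.ne)
  exact tendsto_of_tendsto_of_tendsto_of_le_of_le tendsto_const_nhds h0 (fun _ => zero_le) hle

theorem HasTracedGradient.of_tendsto {w₀ w₁ w : ℕ → ℝ × ℝ → ℝ} {t : ℕ → ℝ → ℝ}
    {f g₀ g₁ : ℝ × ℝ → ℝ} {τ : ℝ → ℝ} (hw : ∀ n, HasTracedGradient (w n) (w₀ n) (w₁ n) (t n))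
    (hf : MemLp f 2 (volume.restrict unitSquare)) (hg₀ : MemLp g₀ 2 (volume.restrict unitSquare))
    (hg₁ : MemLp g₁ 2 (volume.restrict unitSquare)) (hτ : MemLp τ 2 (volume.restrict (Ioo 0 1)))
    (h : Tendsto (fun n => eLpNorm (fun x => w n x - f x) 2 (volume.restrict unitSquare))
      atTop (𝓝 0))
    (h₀ : Tendsto (fun n => eLpNorm (fun x => w₀ n x - g₀ x) 2 (volume.restrict unitSquare))
      atTop (𝓝 0))
    (h₁ : Tendsto (fun n => eLpNorm (fun x => w₁ n x - g₁ x) 2 (volume.restrict unitSquare))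
      atTop (𝓝 0))
    (ht : Tendsto (fun n => eLpNorm (fun y => t n y - τ y) 2 (volume.restrict (Ioo 0 1)))
      atTop (𝓝 0)) : HasTracedGradient f g₀ g₁ τ where
  memLp := hf
  memLp_zero := hg₀
  memLp_one := hg₁
  memLp_trace := hτ
  integral_zero Z hZ hZ1 := by
    refine tendsto_nhds_unique (tendsto_integral_mul_of_eLpNorm (fun n => (hw n).memLp_zero) hg₀
      (hZ.continuous.memLp_unitSquare 2) h₀) ?_
    simp_rw [(hw _).integral_zero Z hZ hZ1]
    exact (tendsto_integral_mul_of_eLpNorm (fun n => (hw n).memLp) hf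
      ((continuous_partialD hZ 0).memLp_unitSquare 2) h).neg.sub
      (tendsto_integral_mul_of_eLpNorm (fun n => (hw n).memLp_trace) hτ
      ((hZ.continuous.comp (Continuous.prodMk_right 0)).memLp_unitInterval 2) ht)
  integral_one Z hZ hZ0 hZ1 := by
    refine tendsto_nhds_unique (tendsto_integral_mul_of_eLpNorm (fun n => (hw n).memLp_one) hg₁
      (hZ.continuous.memLp_unitSquare 2) h₁) ?_
    simp_rw [(hw _).integral_one Z hZ hZ0 hZ1]
    exact (tendsto_integral_mul_of_eLpNorm (fun n => (hw n).memLp) hf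
      ((continuous_partialD hZ 1).memLp_unitSquare 2) h).neg

theorem IsLeftTrace.hasTracedGradient {u : ℝ × ℝ → Vec2} {T : ℝ → Vec2} (hT : IsLeftTrace u T)
    (hu : MemW12 u) (i : Fin 2) :
    HasTracedGradient (fun x => u x i) (fun x => weakGrad u x i 0) (fun x => weakGrad u x i 1)
      fun y => T y i := by
  obtain ⟨hT2, w, hw, h, hd, ht⟩ := hT
  have hwi : ∀ n, ContDiff ℝ 1 fun x => w n x i := fun n => by
    have := hw n
    exact (contDiff_piLp 2).1 this i
  refine HasTracedGradient.of_tendsto (fun n => HasTracedGradient.of_contDiff (hwi n))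
    (hu.1.mono ((PiLp.continuous_apply 2 _ i).comp_aestronglyMeasurable hu.1.1)
      (Eventually.of_forall fun x => PiLp.norm_apply_le (u x) i))
    (hu.isL2WeakGradient.memLp i 0)
    (hu.isL2WeakGradient.memLp i 1)
    (hT2.mono ((PiLp.continuous_apply 2 _ i).comp_aestronglyMeasurable hT2.1)
      (Eventually.of_forall fun x => PiLp.norm_apply_le (T x) i)) ?_ (hd i 0) (hd i 1) ?_
  · exact tendsto_of_tendsto_of_tendsto_of_le_of_le tendsto_const_nhds h (fun _ => zero_le)
      fun n => eLpNorm_mono fun x => PiLp.norm_apply_le (w n x - u x) i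
  · exact tendsto_of_tendsto_of_tendsto_of_le_of_le tendsto_const_nhds ht (fun _ => zero_le)
      fun n => eLpNorm_mono fun y => PiLp.norm_apply_le (w n (0, y) - T y) i

theorem integral_sub_mul_of_memLp {α : Type*} [MeasurableSpace α] {μ : Measure α}
    {A B ψ : α → ℝ} (hA : MemLp A 2 μ) (hB : MemLp B 2 μ) (hψ : MemLp ψ 2 μ) :
    ∫ x, (A x - B x) * ψ x ∂μ = (∫ x, A x * ψ x ∂μ) - ∫ x, B x * ψ x ∂μ := by
  simp_rw [sub_mul]
  exact integral_sub (hA.integrable_mul hψ) (hB.integrable_mul hψ)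

theorem HasTracedGradient.sub {f g₀ g₁ f' g₀' g₁' : ℝ × ℝ → ℝ} {τ τ' : ℝ → ℝ}
    (h : HasTracedGradient f g₀ g₁ τ) (h' : HasTracedGradient f' g₀' g₁' τ') :
    HasTracedGradient (fun x => f x - f' x) (fun x => g₀ x - g₀' x) (fun x => g₁ x - g₁' x)
      fun y => τ y - τ' y where
  memLp := h.memLp.sub h'.memLp
  memLp_zero := h.memLp_zero.sub h'.memLp_zero
  memLp_one := h.memLp_one.sub h'.memLp_one
  memLp_trace := h.memLp_trace.sub h'.memLp_trace
  integral_zero Z hZ hZ1 := by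
    have hZ2 := hZ.continuous.memLp_unitSquare 2
    have hZd := (continuous_partialD hZ 0).memLp_unitSquare 2
    have hZt := (hZ.continuous.comp (Continuous.prodMk_right 0)).memLp_unitInterval 2
    have e := integral_sub_mul_of_memLp h.memLp_trace h'.memLp_trace hZt
    simp only [Function.comp_apply] at e
    rw [integral_sub_mul_of_memLp h.memLp_zero h'.memLp_zero hZ2,
      integral_sub_mul_of_memLp h.memLp h'.memLp hZd, e, h.integral_zero Z hZ hZ1, h'.integral_zero Z hZ hZ1]
    ring
  integral_one Z hZ hZ0 hZ1 := by
    have hZ2 := hZ.continuous.memLp_unitSquare 2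
    have hZd := (continuous_partialD hZ 1).memLp_unitSquare 2
    rw [integral_sub_mul_of_memLp h.memLp_one h'.memLp_one hZ2,
      integral_sub_mul_of_memLp h.memLp h'.memLp hZd, h.integral_one Z hZ hZ0 hZ1, h'.integral_one Z hZ hZ0 hZ1]
    ring

theorem partialD_const_mul_snd (β : ℝ) :
    partialD 0 (fun x : ℝ × ℝ => β * x.2) = (fun _ => 0) ∧
      partialD 1 (fun x : ℝ × ℝ => β * x.2) = fun _ => β := by
  have hd : ContDiff ℝ 1 fun x : ℝ × ℝ => β * x.2 := by fun_prop
  constructor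
  · ext ⟨s, y⟩
    exact (hasDerivAt_slice_fst (hd.differentiable one_ne_zero (s, y))).unique
      (hasDerivAt_const s (β * y))
  · ext ⟨s, y⟩
    refine (hasDerivAt_slice_snd (hd.differentiable one_ne_zero (s, y))).unique ?_
    simpa using (hasDerivAt_id y).const_mul β

theorem HasTracedGradient.sub_linear {f g₀ g₁ : ℝ × ℝ → ℝ} {τ : ℝ → ℝ}
    (h : HasTracedGradient f g₀ g₁ τ) (β : ℝ) :
    HasTracedGradient (fun x => f x - β * x.2) g₀ (fun x => g₁ x - β) fun y => τ y - β * y := by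
  have h' := HasTracedGradient.of_contDiff (w := fun x : ℝ × ℝ => β * x.2) (by fun_prop)
  rw [(partialD_const_mul_snd β).1, (partialD_const_mul_snd β).2] at h'
  simpa using h.sub h'

theorem HasTracedGradient.integral_mul_tail {f g₀ g₁ : ℝ × ℝ → ℝ} {τ : ℝ → ℝ}
    (h : HasTracedGradient f g₀ g₁ τ) {D : ℝ × ℝ → ℝ} (hD : ContDiff ℝ 1 D) :
    ∫ x in unitSquare, f x * D x = (∫ x in unitSquare, g₀ x * tailPrimitive D x) +
      ∫ y in Ioo (0:ℝ) 1, τ y * tailPrimitive D (0, y) := by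
  have := h.integral_zero _ (contDiff_tailPrimitive hD) (by simp [tailPrimitive])
  simp_rw [partialD_zero_tailPrimitive hD, mul_neg, integral_neg] at this
  linarith

theorem ae_dist_le_of_essOsc_le {g : ℝ → Vec2} {ℓ : ℝ}
    (h : ∀ a b : ℝ, 0 ≤ a → a < b → b ≤ 1 → essOsc g (Ioo a b) ≤ ENNReal.ofReal (ℓ * (b - a)))
    (hℓ : 0 ≤ ℓ) :
    ∀ᵐ p : ℝ × ℝ ∂(volume.prod volume), p.1 ∈ Ioo (0:ℝ) 1 → p.2 ∈ Ioo (0:ℝ) 1 →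
      ‖g p.1 - g p.2‖ ≤ ℓ * |p.1 - p.2| := by
  have key : ∀ᵐ p : ℝ × ℝ ∂(volume.prod volume), ∀ q q' : ℚ, 0 ≤ q → q < q' → q' ≤ 1 →
      p.1 ∈ Ioo (q:ℝ) q' → p.2 ∈ Ioo (q:ℝ) q' → ‖g p.1 - g p.2‖ ≤ ℓ * (q' - q) := by
    refine ae_all_iff.2 fun q => ae_all_iff.2 fun q' => ?_
    by_cases hq : 0 ≤ q ∧ q < q' ∧ q' ≤ 1
    · have hlt : (q:ℝ) < q' := by exact_mod_cast hq.2.1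
      have := h q q' (by exact_mod_cast hq.1) hlt (by exact_mod_cast hq.2.2)
      have h2 := ENNReal.ae_le_essSup (μ := (volume.restrict (Ioo (q:ℝ) q')).prod
        (volume.restrict (Ioo (q:ℝ) q'))) fun p : ℝ × ℝ => ‖g p.1 - g p.2‖ₑ
      rw [Measure.prod_restrict, ae_restrict_iff' (measurableSet_Ioo.prod measurableSet_Ioo)] at h2
      filter_upwards [h2] with p hp _ _ _ hp1 hp2
      have h3 := (hp ⟨hp1, hp2⟩).trans ((le_of_eq (by rw [essOsc, Measure.prod_restrict])).trans this)
      rw [← ofReal_norm] at h3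
      exact (ENNReal.ofReal_le_ofReal_iff (mul_nonneg hℓ (sub_nonneg.2 hlt.le))).1 h3
    · exact Eventually.of_forall fun p h0 h1 h2 => absurd ⟨h0, h1, h2⟩ hq
  have main : ∀ p : ℝ × ℝ, (∀ q q' : ℚ, 0 ≤ q → q < q' → q' ≤ 1 →
      p.1 ∈ Ioo (q:ℝ) q' → p.2 ∈ Ioo (q:ℝ) q' → ‖g p.1 - g p.2‖ ≤ ℓ * (q' - q)) →
      ∀ x y : ℝ, x < y → 0 < x → y < 1 → (p = (x, y) ∨ p = (y, x)) →
      ‖g p.1 - g p.2‖ ≤ ℓ * (y - x) := by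
    intro p hp x y hxy hx hy hpe
    refine le_of_forall_pos_le_add fun δ hδ => ?_
    have hδ' : 0 < δ / (2 * (ℓ + 1)) := by positivity
    obtain ⟨q, hq1, hq2⟩ := exists_rat_btwn (max_lt hx (sub_lt_self x hδ'))
    obtain ⟨q', hq1', hq2'⟩ := exists_rat_btwn (lt_min hy (lt_add_of_pos_right y hδ'))
    rw [max_lt_iff] at hq1
    rw [lt_min_iff] at hq2'
    have hqq : (q:ℝ) < q' := by linarith
    have hmem : x ∈ Ioo (q:ℝ) q' ∧ y ∈ Ioo (q:ℝ) q' := by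
      constructor <;> constructor <;> linarith
    have h1 : ‖g p.1 - g p.2‖ ≤ ℓ * (q' - q) := by
      refine hp q q' (by exact_mod_cast hq1.1.le) (by exact_mod_cast hqq)
        (by exact_mod_cast hq2'.1.le) ?_ ?_ <;> rcases hpe with rfl | rfl <;> simp only [hmem]
    have h2 : ℓ * (q' - q) ≤ ℓ * (y - x + 2 * (δ / (2 * (ℓ + 1)))) :=
      mul_le_mul_of_nonneg_left (by linarith) hℓ
    have h3 : ℓ * (2 * (δ / (2 * (ℓ + 1)))) ≤ δ := by
      have : ℓ * (2 * (δ / (2 * (ℓ + 1)))) = δ * (ℓ / (ℓ + 1)) := by field_simp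
      rw [this]
      exact mul_le_of_le_one_right hδ.le ((div_le_one (by positivity)).2 (by linarith))
    rw [mul_add] at h2
    linarith
  filter_upwards [key] with p hp h1 h2
  rcases lt_trichotomy p.1 p.2 with hlt | heq | hgt
  · have := main p hp p.1 p.2 hlt h1.1 h2.2 (Or.inl rfl)
    rwa [abs_sub_comm, abs_of_pos (sub_pos.2 hlt)]
  · simp [heq]
  · have := main p hp p.2 p.1 hgt h2.1 h1.2 (Or.inr rfl)
    rwa [abs_of_pos (sub_pos.2 hgt)]

theorem exists_lipschitzWith_ae_eq {τ : ℝ → ℝ} {ℓ : NNReal}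
    (h : ∀ᵐ p : ℝ × ℝ ∂(volume.prod volume), p.1 ∈ Ioo (0:ℝ) 1 → p.2 ∈ Ioo (0:ℝ) 1 →
      |τ p.1 - τ p.2| ≤ ℓ * |p.1 - p.2|) :
    ∃ τ' : ℝ → ℝ, LipschitzWith ℓ τ' ∧ τ =ᵐ[volume.restrict (Ioo (0:ℝ) 1)] τ' := by
  have h1 := Measure.ae_ae_of_ae_prod h
  have hl : LipschitzOnWith ℓ τ {y | y ∈ Ioo (0:ℝ) 1 ∧ ∀ᵐ z, y ∈ Ioo (0:ℝ) 1 →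
      z ∈ Ioo (0:ℝ) 1 → |τ y - τ z| ≤ ℓ * |y - z|} := by
    refine LipschitzOnWith.of_dist_le_mul fun y hy y' hy' => ?_
    refine le_of_forall_pos_le_add fun δ hδ => ?_
    have hopen : IsOpen (Metric.ball y (δ / (2 * (ℓ + 1))) ∩ Ioo (0:ℝ) 1) :=
      Metric.isOpen_ball.inter isOpen_Ioo
    have hne : (Metric.ball y (δ / (2 * (ℓ + 1))) ∩ Ioo (0:ℝ) 1).Nonempty :=
      ⟨y, Metric.mem_ball_self (by positivity), hy.1⟩
    have hfreq : ∃ᵐ z, z ∈ Metric.ball y (δ / (2 * ((ℓ:ℝ) + 1))) ∩ Ioo (0:ℝ) 1 :=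
      frequently_ae_mem_iff.2 (hopen.measure_pos volume hne).ne'
    obtain ⟨z, ⟨hz1, hz2⟩, hz3, hz4⟩ := (hfreq.and_eventually (hy.2.and hy'.2)).exists
    have e1 := hz3 hy.1 hz2
    have e2 := hz4 hy'.1 hz2
    rw [Metric.mem_ball, Real.dist_eq, abs_sub_comm] at hz1
    have e3 : |y' - z| ≤ |y - y'| + |y - z| := by
      have := abs_sub_le y' y z
      rwa [abs_sub_comm y' y] at this
    have e4 : |τ y - τ y'| ≤ |τ y - τ z| + |τ y' - τ z| := by
      have := abs_sub_le (τ y) (τ z) (τ y')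
      rwa [abs_sub_comm (τ z) (τ y')] at this
    have e5 : (ℓ:ℝ) * |y' - z| ≤ ℓ * |y - y'| + ℓ * |y - z| := by
      rw [← mul_add]; exact mul_le_mul_of_nonneg_left e3 ℓ.2
    have e6 : (ℓ:ℝ) * |y - z| ≤ δ / 2 := by
      refine (mul_le_mul_of_nonneg_left hz1.le ℓ.2).trans ?_
      have : (ℓ:ℝ) * (δ / (2 * (ℓ + 1))) = δ / 2 * (ℓ / (ℓ + 1)) := by
        field_simp
      change (ℓ:ℝ) * (δ / (2 * (ℓ + 1))) ≤ δ / 2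
      rw [this]
      exact mul_le_of_le_one_right (by linarith)
        ((div_le_one (by positivity)).2 (by linarith))
    rw [Real.dist_eq, Real.dist_eq]
    linarith
  obtain ⟨τ', hτ', he⟩ := hl.extend_real
  refine ⟨τ', hτ', ?_⟩
  filter_upwards [ae_restrict_mem measurableSet_Ioo, ae_restrict_of_ae h1] with y hy hy'
  exact he ⟨hy, hy'⟩

/-- The estimate that characterises functions with Lipschitz constant `ℓ` by duality. -/
def LipschitzByDuality (ℓ : ℝ) (τ : ℝ → ℝ) : Prop :=
  ∀ p p' : ℝ → ℝ, (∀ y, HasDerivAt p (p' y) y) → Continuous p' → p 0 = 0 → p 1 = 0 →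
    |∫ y in Ioo (0:ℝ) 1, τ y * p' y| ≤ ℓ * ∫ y in Ioo (0:ℝ) 1, |p y|

theorem lipschitzByDuality_of_ae_dist_le {τ : ℝ → ℝ} {ℓ : ℝ} (hℓ : 0 ≤ ℓ)
    (h : ∀ᵐ p : ℝ × ℝ ∂(volume.prod volume), p.1 ∈ Ioo (0:ℝ) 1 → p.2 ∈ Ioo (0:ℝ) 1 →
      |τ p.1 - τ p.2| ≤ ℓ * |p.1 - p.2|) : LipschitzByDuality ℓ τ := by
  lift ℓ to NNReal using hℓ
  obtain ⟨τ', hτ', he⟩ := exists_lipschitzWith_ae_eq h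
  intro p p' hp hp' h0 h1
  have hpc : Continuous p := continuous_iff_continuousAt.2 fun y => (hp y).continuousAt
  have hpd : deriv p = p' := funext fun y => (hp y).deriv
  have hpC : ContDiff ℝ 1 p := by
    rw [contDiff_one_iff_deriv, hpd]
    exact ⟨fun y => (hp y).differentiableAt, hp'⟩
  have hac : AbsolutelyContinuousOnInterval p 0 1 :=
    hpC.contDiffOn.absolutelyContinuousOnInterval
  have hac' : AbsolutelyContinuousOnInterval τ' 0 1 :=
    (hτ'.lipschitzOnWith (s := uIcc 0 1)).absolutelyContinuousOnInterval
  have hparts := hac'.integral_mul_deriv_eq_deriv_mul hac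
  rw [h0, h1, hpd, intervalIntegral.integral_of_le zero_le_one,
    intervalIntegral.integral_of_le zero_le_one, integral_Ioc_eq_integral_Ioo,
    integral_Ioc_eq_integral_Ioo] at hparts
  have e1 : ∫ y in Ioo (0:ℝ) 1, τ y * p' y = ∫ y in Ioo (0:ℝ) 1, τ' y * p' y := by
    refine integral_congr_ae ?_
    filter_upwards [he] with y hy
    rw [hy]
  rw [e1, hparts, mul_zero, mul_zero, sub_zero, zero_sub, abs_neg, ← integral_const_mul,
    ← Real.norm_eq_abs (∫ y in Ioo (0:ℝ) 1, deriv τ' y * p y)]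
  refine norm_integral_le_of_norm_le (hpc.abs.integrableOn_unitInterval.const_mul _)
    (Eventually.of_forall fun y => ?_)
  rw [norm_mul]
  exact mul_le_mul_of_nonneg_right (norm_deriv_le_of_lipschitz hτ') (norm_nonneg _)

theorem lipschitzByDuality_of_essOsc_le {g : ℝ → Vec2} {ℓ : ℝ}
    (h : ∀ a b : ℝ, 0 ≤ a → a < b → b ≤ 1 → essOsc g (Ioo a b) ≤ ENNReal.ofReal (ℓ * (b - a)))
    (hℓ : 0 ≤ ℓ) (i : Fin 2) : LipschitzByDuality ℓ fun y => g y i := by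
  refine lipschitzByDuality_of_ae_dist_le hℓ ?_
  filter_upwards [ae_dist_le_of_essOsc_le h hℓ] with p hp h1 h2
  exact (PiLp.norm_apply_le (g p.1 - g p.2) i).trans (hp h1 h2)

theorem exists_contDiff_cutoff {K U : Set (ℝ × ℝ)} (hK : IsCompact K) (hU : IsOpen U)
    (hKU : K ⊆ U) : ∃ χ : ℝ × ℝ → ℝ, ContDiff ℝ ∞ χ ∧ HasCompactSupport χ ∧ tsupport χ ⊆ U ∧
      (∀ x, χ x ∈ Icc (0:ℝ) 1) ∧ ∀ x ∈ K, χ x = 1 := by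
  obtain ⟨V, hV, hKV, hVU, hVc⟩ := exists_open_between_and_isCompact_closure hK hU hKU
  obtain ⟨f, hf, hr, hs, ht⟩ := exists_contMDiff_support_eq_eq_one_iff (n := ⊤)
    (modelWithCornersSelf ℝ (ℝ × ℝ)) hV hK.isClosed hKV
  have hts : tsupport f = closure V := by rw [tsupport, hs]
  exact ⟨f, hf.contDiff, by rw [HasCompactSupport, hts]; exact hVc, by rw [hts]; exact hVU,
    fun x => hr ⟨x, rfl⟩, fun x hx => (ht x).1 hx⟩

theorem contDiff_mul_of_tsupport_subset {χ k : ℝ × ℝ → ℝ} {U : Set (ℝ × ℝ)} (hU : IsOpen U)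
    (hχ : ContDiff ℝ ∞ χ) (hk : ContDiffOn ℝ ∞ k U) (h : tsupport χ ⊆ U) :
    ContDiff ℝ ∞ fun x => χ x * k x := by
  refine contDiff_iff_contDiffAt.2 fun x => ?_
  by_cases hx : x ∈ tsupport χ
  · exact hχ.contDiffAt.mul (hk.contDiffAt (hU.mem_nhds (h hx)))
  · refine (contDiffAt_const (c := (0:ℝ))).congr_of_eventuallyEq ?_
    filter_upwards [notMem_tsupport_iff_eventuallyEq.1 hx] with y hy
    simp [hy]

theorem exists_contDiff_tendsto_sign {g : ℝ × ℝ → ℝ}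
    (hg : AEStronglyMeasurable g (volume.restrict unitSquare)) :
    ∃ ζ : ℕ → ℝ × ℝ → ℝ, (∀ n, ContDiff ℝ ∞ (ζ n)) ∧ (∀ n x, |ζ n x| ≤ 1) ∧
      ∀ᵐ x ∂(volume.restrict unitSquare),
        Tendsto (fun n => g x * ζ n x) atTop (𝓝 |g x|) := by
  set S : ℝ × ℝ → ℝ := fun x => if 0 ≤ hg.mk g x then 1 else -1 with hS
  have hSm : Measurable S := Measurable.ite
    (measurableSet_le measurable_const hg.stronglyMeasurable_mk.measurable)
    measurable_const measurable_const
  have hS1 : ∀ x, S x = 1 ∨ S x = -1 := fun x => by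
    by_cases h : 0 ≤ hg.mk g x
    · exact Or.inl (if_pos h)
    · exact Or.inr (if_neg h)
  have hSL : MemLp (unitSquare.indicator S) 1 volume := by
    rw [memLp_indicator_iff_restrict measurableSet_unitSquare]
    refine MemLp.of_bound hSm.aestronglyMeasurable 1 (Eventually.of_forall fun x => ?_)
    rcases hS1 x with h | h <;> simp [h]
  have happ : ∀ n : ℕ, ∃ φ : ℝ × ℝ → ℝ, HasCompactSupport φ ∧ ContDiff ℝ ∞ φ ∧
      eLpNorm (unitSquare.indicator S - φ) 1 volume ≤ ENNReal.ofReal (1 / ((n:ℝ) + 1)) := fun n =>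
    MemLp.exist_eLpNorm_sub_le ENNReal.one_ne_top le_rfl hSL (by positivity)
  choose φ hφc hφ hφe using happ
  have hto : Tendsto (fun n => eLpNorm (φ n - unitSquare.indicator S) 1 volume) atTop (𝓝 0) := by
    simp_rw [eLpNorm_sub_comm (φ _)]
    refine tendsto_of_tendsto_of_tendsto_of_le_of_le tendsto_const_nhds ?_ (fun _ => zero_le) hφe
    have := (ENNReal.continuous_ofReal.tendsto 0).comp
      (tendsto_one_div_add_atTop_nhds_zero_nat (𝕜 := ℝ))
    simpa [Function.comp_def] using this
  obtain ⟨ns, -, hns⟩ := (tendstoInMeasure_of_tendsto_eLpNorm one_ne_zero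
    (fun n => (hφ n).continuous.aestronglyMeasurable) hSL.1 hto).exists_seq_tendsto_ae
  have hpos : ∀ t : ℝ, (0:ℝ) < 1 + t ^ 2 := fun t => by positivity
  refine ⟨fun n x => 2 * φ (ns n) x / (1 + φ (ns n) x ^ 2), fun n => ?_, fun n x => ?_, ?_⟩
  · exact (contDiff_const.mul (hφ _)).div (contDiff_const.add ((hφ _).pow 2))
      fun x => (hpos _).ne'
  · rw [abs_div, abs_of_pos (hpos _), div_le_one (hpos _), abs_le]
    constructor <;> nlinarith [sq_nonneg (φ (ns n) x - 1), sq_nonneg (φ (ns n) x + 1)]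
  · filter_upwards [ae_restrict_of_ae hns, ae_restrict_mem measurableSet_unitSquare, hg.ae_eq_mk]
      with x hx hxQ hgx
    rw [indicator_of_mem hxQ] at hx
    have h1 : Tendsto (fun n => g x * (2 * φ (ns n) x / (1 + φ (ns n) x ^ 2))) atTop
        (𝓝 (g x * (2 * S x / (1 + S x ^ 2)))) :=
      ((hx.const_mul 2).div ((hx.pow 2).const_add 1) (hpos _).ne').const_mul _
    convert h1 using 2
    simp only [hS]
    rw [← hgx]
    split_ifs with h
    · rw [abs_of_nonneg h]; norm_num
    · rw [abs_of_neg (not_le.1 h)]; norm_num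

theorem setIntegral_abs_mul_le_of_forall {g k : ℝ × ℝ → ℝ} {K U : Set (ℝ × ℝ)} {B C : ℝ}
    (hK : IsCompact K) (hU : IsOpen U) (hKU : K ⊆ U) (hUQ : U ⊆ unitSquare)
    (hg : MemLp g 2 (volume.restrict unitSquare)) (hk : ContDiffOn ℝ ∞ k U)
    (hk0 : ∀ x ∈ unitSquare, 0 ≤ k x) (hkC : ∀ x ∈ unitSquare, k x ≤ C)
    (h : ∀ σ : ℝ × ℝ → ℝ, ContDiff ℝ ∞ σ → HasCompactSupport σ → tsupport σ ⊆ U →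
      (∀ x ∈ unitSquare, |σ x| ≤ k x) → ∫ x in unitSquare, g x * σ x ≤ B) :
    ∫ x in K, |g x| * k x ≤ B := by
  obtain ⟨χ, hχ, hχc, hχU, hχ01, hχ1⟩ := exists_contDiff_cutoff hK hU hKU
  obtain ⟨ζ, hζ, hζ1, hζt⟩ := exists_contDiff_tendsto_sign hg.1
  have hχk := contDiff_mul_of_tsupport_subset hU hχ hk hχU
  have hgi : Integrable g (volume.restrict unitSquare) := hg.integrable (by norm_num)
  have hbd : ∀ x ∈ unitSquare, |χ x * k x| ≤ k x := fun x hx => by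
    rw [abs_mul, abs_of_nonneg (hχ01 x).1, abs_of_nonneg (hk0 x hx)]
    exact mul_le_of_le_one_left (hk0 x hx) (hχ01 x).2
  have hbd' : ∀ n, ∀ x ∈ unitSquare, |ζ n x * (χ x * k x)| ≤ k x := fun n x hx => by
    rw [abs_mul]
    exact (mul_le_of_le_one_left (abs_nonneg _) (hζ1 n x)).trans (hbd x hx)
  have hle : ∀ n, ∫ x in unitSquare, g x * (ζ n x * (χ x * k x)) ≤ B := fun n => by
    have hss : tsupport (fun x => ζ n x * (χ x * k x)) ⊆ tsupport χ :=
      closure_mono fun x hx hx' => hx (by simp [hx'])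
    exact h _ ((hζ n).mul hχk) (hχc.of_isClosed_subset (isClosed_tsupport _) hss)
      (hss.trans hχU) (hbd' n)
  have hlim : Tendsto (fun n => ∫ x in unitSquare, g x * (ζ n x * (χ x * k x))) atTop
      (𝓝 (∫ x in unitSquare, |g x| * (χ x * k x))) := by
    refine tendsto_integral_of_dominated_convergence (fun x => |g x| * C)
      (fun n => hgi.1.mul ((hζ n).continuous.mul hχk.continuous).aestronglyMeasurable)
      (hgi.abs.mul_const C) (fun n => ?_) ?_
    · filter_upwards [ae_restrict_mem measurableSet_unitSquare] with x hx
      rw [norm_mul]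
      exact mul_le_mul_of_nonneg_left ((hbd' n x hx).trans (hkC x hx)) (norm_nonneg _)
    · filter_upwards [hζt] with x hx
      simp_rw [← mul_assoc (g x)]
      exact hx.mul_const _
  refine le_trans ?_ (le_of_tendsto' hlim hle)
  have hint : IntegrableOn (fun x => |g x| * (χ x * k x)) unitSquare := by
    refine (hgi.abs.mul_const C).mono' (hgi.abs.1.mul hχk.continuous.aestronglyMeasurable) ?_
    filter_upwards [ae_restrict_mem measurableSet_unitSquare] with x hx
    rw [norm_mul, Real.norm_eq_abs, abs_abs]
    exact mul_le_mul_of_nonneg_left ((hbd x hx).trans (hkC x hx)) (abs_nonneg _)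
  calc ∫ x in K, |g x| * k x = ∫ x in K, |g x| * (χ x * k x) :=
        setIntegral_congr_fun hK.measurableSet fun x hx => by simp [hχ1 x hx]
    _ ≤ ∫ x in unitSquare, |g x| * (χ x * k x) := by
        refine setIntegral_mono_set hint ?_ (hKU.trans hUQ).eventuallyLE
        filter_upwards [ae_restrict_mem measurableSet_unitSquare] with x hx
        exact mul_nonneg (abs_nonneg _) (mul_nonneg (hχ01 x).1 (hk0 x hx))

/-! ### The averaging kernel -/

/-- A nonnegative kernel on `[0,1]` with unit mass, vanishing to second order at both ends. -/
def bumpKernel (τ : ℝ) : ℝ := 30 * τ ^ 2 - 60 * τ ^ 3 + 30 * τ ^ 4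

/-- The derivative of `bumpKernel`. -/
def bumpKernelDeriv (τ : ℝ) : ℝ := 60 * τ - 180 * τ ^ 2 + 120 * τ ^ 3

/-- The second derivative of `bumpKernel`. -/
def bumpKernelDeriv2 (τ : ℝ) : ℝ := 60 - 360 * τ + 360 * τ ^ 2

/-- The mass of `bumpKernel` on `[τ,1]`. -/
def bumpKernelTail (τ : ℝ) : ℝ := 1 - (10 * τ ^ 3 - 15 * τ ^ 4 + 6 * τ ^ 5)

theorem hasDerivAt_bumpKernel (τ : ℝ) : HasDerivAt bumpKernel (bumpKernelDeriv τ) τ := by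
  have h := (((hasDerivAt_pow 2 τ).const_mul 30).sub ((hasDerivAt_pow 3 τ).const_mul 60)).add
    ((hasDerivAt_pow 4 τ).const_mul 30)
  refine h.congr_deriv ?_
  simp only [bumpKernelDeriv]; norm_num; ring

theorem hasDerivAt_bumpKernelDeriv (τ : ℝ) :
    HasDerivAt bumpKernelDeriv (bumpKernelDeriv2 τ) τ := by
  have h := (((hasDerivAt_id τ).const_mul 60).sub ((hasDerivAt_pow 2 τ).const_mul 180)).add
    ((hasDerivAt_pow 3 τ).const_mul 120)
  refine h.congr_deriv ?_
  simp only [bumpKernelDeriv2]; norm_num; ring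

theorem hasDerivAt_bumpKernelTail (τ : ℝ) : HasDerivAt bumpKernelTail (-bumpKernel τ) τ := by
  have h := ((((hasDerivAt_pow 3 τ).const_mul 10).sub ((hasDerivAt_pow 4 τ).const_mul 15)).add
    ((hasDerivAt_pow 5 τ).const_mul 6)).const_sub 1
  refine h.congr_deriv ?_
  simp only [bumpKernel]; norm_num; ring

theorem contDiff_bumpKernel {n : WithTop ℕ∞} : ContDiff ℝ n bumpKernel := by
  unfold bumpKernel; fun_prop

theorem contDiff_bumpKernelDeriv {n : WithTop ℕ∞} : ContDiff ℝ n bumpKernelDeriv := by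
  unfold bumpKernelDeriv; fun_prop

theorem contDiff_bumpKernelTail {n : WithTop ℕ∞} : ContDiff ℝ n bumpKernelTail := by
  unfold bumpKernelTail; fun_prop

theorem continuous_bumpKernelDeriv2 : Continuous bumpKernelDeriv2 := by
  unfold bumpKernelDeriv2; fun_prop

theorem bumpKernel_nonneg (τ : ℝ) : 0 ≤ bumpKernel τ := by
  have : bumpKernel τ = 30 * (τ * (1 - τ)) ^ 2 := by unfold bumpKernel; ring
  rw [this]; positivity

theorem abs_bumpKernelDeriv_le {τ : ℝ} (h : τ ∈ Icc (0:ℝ) 1) : |bumpKernelDeriv τ| ≤ 60 := by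
  obtain ⟨h0, h1⟩ := h
  have e : bumpKernelDeriv τ = 60 * (τ * (1 - τ) * (1 - 2 * τ)) := by unfold bumpKernelDeriv; ring
  rw [e, abs_mul, abs_mul, abs_of_nonneg (mul_nonneg h0 (sub_nonneg.2 h1))]
  have h2 : τ * (1 - τ) ≤ 1 := by nlinarith
  have h3 : |1 - 2 * τ| ≤ 1 := abs_le.2 ⟨by linarith, by linarith⟩
  have h4 : τ * (1 - τ) * |1 - 2 * τ| ≤ 1 := mul_le_one₀ h2 (abs_nonneg _) h3
  rw [abs_of_pos (by norm_num : (0:ℝ) < 60)]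
  linarith

theorem abs_bumpKernelDeriv2_le {τ : ℝ} (h : τ ∈ Icc (0:ℝ) 1) : |bumpKernelDeriv2 τ| ≤ 60 := by
  obtain ⟨h0, h1⟩ := h
  unfold bumpKernelDeriv2
  rw [abs_le]
  constructor <;> nlinarith [sq_nonneg (2 * τ - 1)]

theorem integral_bumpKernel : ∫ τ in (0:ℝ)..1, bumpKernel τ = 1 := by
  have := intervalIntegral.integral_eq_sub_of_hasDerivAt (a := 0) (b := 1)
    (fun τ _ => (hasDerivAt_bumpKernelTail τ).neg)
    (by simpa using (contDiff_bumpKernel (n := 0)).continuous.intervalIntegrable 0 1)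
  simp only [neg_neg, Pi.neg_apply] at this
  rw [this]; norm_num [bumpKernelTail]

theorem abs_bumpKernelTail_le {τ : ℝ} (h : τ ∈ Icc (0:ℝ) 1) : |bumpKernelTail τ| ≤ 1 := by
  have hanti : Antitone bumpKernelTail := antitone_of_deriv_nonpos
    (fun τ => (hasDerivAt_bumpKernelTail τ).differentiableAt) fun τ => by
      rw [(hasDerivAt_bumpKernelTail τ).deriv]; exact neg_nonpos.2 (bumpKernel_nonneg τ)
  have h0 : bumpKernelTail 0 = 1 := by norm_num [bumpKernelTail]
  have h1 : bumpKernelTail 1 = 0 := by norm_num [bumpKernelTail]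
  have := hanti h.1
  have := hanti h.2
  rw [abs_le]; constructor <;> linarith

theorem abs_shiftAverage_bumpKernel_le {ℓ : ℝ → ℝ} {σ : ℝ × ℝ → ℝ} {B s : ℝ}
    (hσ : ∀ y, |σ (s, y)| ≤ B) (y : ℝ) : |shiftAverage bumpKernel ℓ σ (s, y)| ≤ B := by
  have := intervalIntegral.norm_integral_le_of_norm_le (a := (0:ℝ)) (b := 1) (μ := volume)
    (f := fun τ => bumpKernel τ * σ (s, y - ℓ s * τ)) (g := fun τ => bumpKernel τ * B) zero_le_one
    (Eventually.of_forall fun τ _ => by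
      rw [norm_mul, Real.norm_of_nonneg (bumpKernel_nonneg τ)]
      exact mul_le_mul_of_nonneg_left (hσ _) (bumpKernel_nonneg τ))
    (((contDiff_bumpKernel (n := 0)).continuous.mul continuous_const).intervalIntegrable _ _)
  rw [intervalIntegral.integral_mul_const, integral_bumpKernel, one_mul] at this
  simpa [shiftAverage] using this

/-! ### Supports -/

theorem shiftAverage_tsupport {κ ℓ : ℝ → ℝ} {σ : ℝ × ℝ → ℝ} {s₀ : ℝ} (hℓ : Continuous ℓ)
    (hσ : HasCompactSupport σ) (hs : tsupport σ ⊆ Ioo 0 s₀ ×ˢ Ioo (1 / 8) (5 / 8))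
    (hℓ0 : ∀ s ∈ Ioo 0 s₀, ℓ s ∈ Icc (0:ℝ) (1 / 8)) :
    HasCompactSupport (shiftAverage κ ℓ σ) ∧
      tsupport (shiftAverage κ ℓ σ) ⊆ Ioo 0 s₀ ×ˢ Ioo (1 / 8) (3 / 4) := by
  set I : Set (ℝ × ℝ) := (fun z : (ℝ × ℝ) × ℝ => (z.1.1, z.1.2 + ℓ z.1.1 * z.2)) ''
    (tsupport σ ×ˢ Icc (0:ℝ) 1) with hI
  have hIc : IsCompact I :=
    (IsCompact.prod hσ isCompact_Icc).image (by fun_prop)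
  have hsub : tsupport (shiftAverage κ ℓ σ) ⊆ I := by
    refine closure_minimal (fun x hx => ?_) hIc.isClosed
    by_contra hxI
    obtain ⟨s, y⟩ := x
    refine hx (shiftAverage_eq_zero fun τ hτ => ?_)
    by_contra hne
    exact hxI ⟨((s, y - ℓ s * τ), τ), ⟨subset_tsupport _ hne, hτ⟩, by simp⟩
  refine ⟨hIc.of_isClosed_subset (isClosed_tsupport _) hsub, hsub.trans ?_⟩
  rintro _ ⟨⟨⟨s, y⟩, τ⟩, ⟨h1, h2⟩, rfl⟩
  have h3 := hs h1
  have h4 := hℓ0 s h3.1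
  have h5 : ℓ s * τ ≤ 1 / 8 := (mul_le_of_le_one_right h4.1 h2.2).trans h4.2
  have h6 : 0 ≤ ℓ s * τ := mul_nonneg h4.1 h2.1
  exact ⟨h3.1, by linarith [h3.2.1], by linarith [h3.2.2]⟩

/-! ### Bounds in terms of the distance to the left side -/

theorem integral_sq_inv_add_le {a t : ℝ} (ha : 0 < a) (ht : t ∈ Icc (0:ℝ) 1) :
    ∫ s in t..1, ((s + a)⁻¹) ^ 2 ≤ (t + a)⁻¹ := by
  have hpos : ∀ s ∈ uIcc t 1, 0 < s + a := fun s hs => by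
    rw [uIcc_of_le ht.2] at hs; linarith [hs.1, ht.1]
  have hd : ∀ s ∈ uIcc t 1, HasDerivAt (fun s => -(s + a)⁻¹) (((s + a)⁻¹) ^ 2) s := fun s hs => by
    have := (((hasDerivAt_id s).add_const a).fun_inv (hpos s hs).ne').neg
    refine this.congr_deriv ?_
    simp [neg_div]
  have hc : ContinuousOn (fun s => ((s + a)⁻¹) ^ 2) (uIcc t 1) :=
    ((continuousOn_id.add continuousOn_const).inv₀ fun s hs => (hpos s hs).ne').pow 2
  rw [intervalIntegral.integral_eq_sub_of_hasDerivAt hd hc.intervalIntegrable]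
  have : 0 < (1 + a)⁻¹ := by positivity
  linarith

theorem integral_inv_add {a : ℝ} (ha : 0 < a) :
    ∫ s in (0:ℝ)..1, (s + a)⁻¹ = Real.log ((1 + a) / a) := by
  rw [intervalIntegral.integral_comp_add_right (fun s => s⁻¹), zero_add,
    integral_inv_of_pos ha (by linarith)]

theorem intervalIntegrable_pow_inv_add {a t : ℝ} (ha : 0 < a) (ht : t ∈ Icc (0:ℝ) 1) (n : ℕ) :
    IntervalIntegrable (fun s => ((s + a)⁻¹) ^ n) volume t 1 := by
  have hc : ContinuousOn (fun s => ((s + a)⁻¹) ^ n) (uIcc t 1) :=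
    ((continuousOn_id.add continuousOn_const).inv₀ fun s hs => by
      rw [uIcc_of_le ht.2] at hs
      have : (0:ℝ) < s + a := by linarith [hs.1, ht.1]
      exact this.ne').pow n
  exact hc.intervalIntegrable

theorem abs_tailPrimitive_le_pow {f : ℝ × ℝ → ℝ} {a c y t : ℝ} (n : ℕ) (ha : 0 < a) (hc : 0 ≤ c)
    (h : ∀ s ∈ Ioc (0:ℝ) 1, |f (s, y)| ≤ c * ((s + a)⁻¹) ^ (n + 2)) (ht : t ∈ Icc (0:ℝ) 1) :
    |tailPrimitive f (t, y)| ≤ c * ((t + a)⁻¹) ^ (n + 1) := by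
  have hta : 0 < t + a := by linarith [ht.1]
  have h1 := intervalIntegral.norm_integral_le_of_norm_le (a := t) (b := 1) (μ := volume)
    (f := fun s => f (s, y)) (g := fun s => c * ((t + a)⁻¹) ^ n * ((s + a)⁻¹) ^ 2) ht.2
    (Eventually.of_forall fun s hs => by
      have hs0 : s ∈ Ioc (0:ℝ) 1 := ⟨ht.1.trans_lt hs.1, hs.2⟩
      refine (h s hs0).trans ?_
      rw [pow_add, ← mul_assoc]
      have : (s + a)⁻¹ ≤ (t + a)⁻¹ := inv_anti₀ hta (by linarith [hs.1])
      have h0 : 0 ≤ (s + a)⁻¹ := inv_nonneg.2 (by linarith [hs0.1])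
      gcongr)
    ((intervalIntegrable_pow_inv_add ha ht 2).const_mul _)
  rw [intervalIntegral.integral_const_mul] at h1
  refine h1.trans ?_
  rw [pow_succ, ← mul_assoc]
  exact mul_le_mul_of_nonneg_left (integral_sq_inv_add_le ha ht) (by positivity)

theorem abs_tailPrimitive_zero_le {f : ℝ × ℝ → ℝ} {a c y : ℝ} (ha : 0 < a)
    (h : ∀ s ∈ Ioc (0:ℝ) 1, |f (s, y)| ≤ c * (s + a)⁻¹) :
    |tailPrimitive f (0, y)| ≤ c * Real.log ((1 + a) / a) := by
  have h1 := intervalIntegral.norm_integral_le_of_norm_le (a := (0:ℝ)) (b := 1) (μ := volume)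
    (f := fun s => f (s, y)) (g := fun s => c * (s + a)⁻¹) zero_le_one
    (Eventually.of_forall fun s hs => h s hs)
    (by simpa using (intervalIntegrable_pow_inv_add ha (left_mem_Icc.2 zero_le_one) 1).const_mul c)
  rwa [intervalIntegral.integral_const_mul, integral_inv_add ha] at h1

/-- Smooth test functions supported in `(0,s₀) × (1/8,5/8)` and bounded by the weight
`1 / (s + a)`. -/
structure WeightedTest (a s₀ : ℝ) (σ : ℝ × ℝ → ℝ) : Prop where
  contDiff : ContDiff ℝ ∞ σ
  hasCompactSupport : HasCompactSupport σ
  tsupport_subset : tsupport σ ⊆ Ioo 0 s₀ ×ˢ Ioo (1 / 8) (5 / 8)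
  abs_le : ∀ s, 0 < s → ∀ y, |σ (s, y)| ≤ (s + a)⁻¹

/-- The scales `a` (cutoff), `s₀` (width of the layer) and `M` (slope of the averaging length). -/
structure LayerScales (M a s₀ : ℝ) : Prop where
  one_le : 1 ≤ M
  pos : 0 < a
  s₀_pos : 0 < s₀
  le : M * (s₀ + a) ≤ 1 / 8

section

variable {M a s₀ : ℝ} {σ : ℝ × ℝ → ℝ}

theorem LayerScales.s₀_lt (h : LayerScales M a s₀) : s₀ < 1 := by
  nlinarith [h.one_le, h.pos, h.s₀_pos, h.le]

theorem LayerScales.length_mem (h : LayerScales M a s₀) :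
    ∀ s ∈ Ioo 0 s₀, M * (s + a) ∈ Icc (0:ℝ) (1 / 8) := by
  intro s hs
  have hM := h.one_le
  have ha := h.pos
  have hle := h.le
  refine ⟨mul_nonneg (by linarith) (by linarith [hs.1]), le_trans ?_ hle⟩
  exact mul_le_mul_of_nonneg_left (by linarith [hs.2]) (by linarith)

theorem LayerScales.tsupport_shiftAverage (h : LayerScales M a s₀) (κ : ℝ → ℝ)
    {f : ℝ × ℝ → ℝ} (hf : HasCompactSupport f)
    (hs : tsupport f ⊆ Ioo 0 s₀ ×ˢ Ioo (1 / 8) (5 / 8)) :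
    HasCompactSupport (shiftAverage κ (fun s => M * (s + a)) f) ∧
      tsupport (shiftAverage κ (fun s => M * (s + a)) f) ⊆ Ioo 0 s₀ ×ˢ Ioo (1 / 8) (3 / 4) :=
  shiftAverage_tsupport (by fun_prop) hf hs h.length_mem

theorem contDiff_length {n : WithTop ℕ∞} : ContDiff ℝ n fun s => M * (s + a) := by fun_prop

/-- The test function is a derivative up to its average. -/
theorem WeightedTest.exists_partialD_eq (hσ : WeightedTest a s₀ σ) (h : LayerScales M a s₀) :
    ∃ Φ : ℝ × ℝ → ℝ, ContDiff ℝ 1 Φ ∧ HasCompactSupport Φ ∧ tsupport Φ ⊆ unitSquare ∧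
      (∀ x, |Φ x| ≤ M) ∧
      ∀ x, partialD 1 Φ x = σ x - shiftAverage bumpKernel (fun s => M * (s + a)) σ x := by
  have hσ1 : ContDiff ℝ 1 σ := hσ.contDiff.of_le (by norm_cast)
  obtain ⟨hc, hs⟩ := h.tsupport_shiftAverage bumpKernelTail hσ.hasCompactSupport
    hσ.tsupport_subset
  set A := shiftAverage bumpKernelTail (fun s => M * (s + a)) σ with hA
  have hA1 : ContDiff ℝ 1 A := contDiff_shiftAverage contDiff_bumpKernelTail contDiff_length hσ1
  have hss : tsupport (fun x : ℝ × ℝ => M * (x.1 + a) * A x) ⊆ tsupport A :=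
    closure_mono fun x hx hx' => hx (by simp [hx'])
  have hM := h.one_le
  refine ⟨fun x => M * (x.1 + a) * A x, by fun_prop,
    hc.of_isClosed_subset (isClosed_tsupport _) hss, fun x hx => ?_, ?_, ?_⟩
  · obtain ⟨h1, h2⟩ := hs (hss hx)
    exact ⟨⟨h1.1, h1.2.trans h.s₀_lt⟩, by linarith [h2.1], by linarith [h2.2]⟩
  · rintro ⟨s, y⟩
    by_cases hx : (s, y) ∈ tsupport A
    · have hs0 : 0 < s := (hs hx).1.1
      have hsa : 0 < s + a := by linarith [h.pos]
      have hb : |A (s, y)| ≤ 1 * (s + a)⁻¹ :=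
        abs_shiftAverage_le (fun τ hτ => abs_bumpKernelTail_le hτ) (hσ.abs_le s hs0) y
      have hMs : 0 < M * (s + a) := by positivity
      simp only [abs_mul (M * (s + a)), abs_of_pos hMs]
      calc M * (s + a) * |A (s, y)| ≤ M * (s + a) * (1 * (s + a)⁻¹) := by gcongr
        _ = M := by field_simp
    · simp only [image_eq_zero_of_notMem_tsupport hx, mul_zero, abs_zero]
      linarith
  · rintro ⟨s, y⟩
    have hd : ContDiff ℝ 1 fun x : ℝ × ℝ => M * (x.1 + a) * A x := by fun_prop
    have e1 : partialD 1 (fun x : ℝ × ℝ => M * (x.1 + a) * A x) (s, y) =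
        M * (s + a) * partialD 1 A (s, y) :=
      (hasDerivAt_slice_snd (hd.differentiable one_ne_zero (s, y))).unique
        ((hasDerivAt_slice_snd (hA1.differentiable one_ne_zero (s, y))).const_mul (M * (s + a)))
    have e2 := mul_shiftAverage_partialD (ℓ := fun s => M * (s + a)) hasDerivAt_bumpKernelTail
      (contDiff_bumpKernel (n := 0)).continuous.neg hσ1 s y
    have e3 : shiftAverage (fun τ => -bumpKernel τ) (fun s => M * (s + a)) σ (s, y) =
        -shiftAverage bumpKernel (fun s => M * (s + a)) σ (s, y) := by
      simp only [shiftAverage, neg_mul, intervalIntegral.integral_neg]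
    have e4 : bumpKernelTail 0 = 1 := by norm_num [bumpKernelTail]
    have e5 : bumpKernelTail 1 = 0 := by norm_num [bumpKernelTail]
    rw [e1, hA, partialD_one_shiftAverage contDiff_bumpKernelTail contDiff_length hσ1, e2, e3, e4,
      e5]
    ring

/-- The average of a test function together with its first two derivatives. -/
theorem WeightedTest.exists_average (hσ : WeightedTest a s₀ σ) (h : LayerScales M a s₀) :
    ∃ S S₁ S₂ : ℝ × ℝ → ℝ, S = shiftAverage bumpKernel (fun s => M * (s + a)) σ ∧
      ContDiff ℝ 1 S ∧ ContDiff ℝ 1 S₁ ∧ ContDiff ℝ 1 S₂ ∧ partialD 1 S = S₁ ∧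
      partialD 1 S₁ = S₂ ∧
      (∀ s, S (s, 0) = 0 ∧ S (s, 1) = 0 ∧ S₁ (s, 0) = 0 ∧ S₁ (s, 1) = 0) ∧
      (∀ s y, 0 < s → |S (s, y)| ≤ (s + a)⁻¹) ∧
      (∀ s y, 0 < s → |S₁ (s, y)| ≤ 60 / M * ((s + a)⁻¹) ^ 2) ∧
      ∀ s y, 0 < s → |S₂ (s, y)| ≤ 60 / M ^ 2 * ((s + a)⁻¹) ^ 3 := by
  have h1le : (1 : WithTop ℕ∞) ≤ (∞ : WithTop ℕ∞) := by norm_cast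
  have hσ1 : ContDiff ℝ 1 σ := hσ.contDiff.of_le h1le
  have hdσ := contDiff_partialD hσ.contDiff 1
  have hdσ1 : ContDiff ℝ 1 (partialD 1 σ) := hdσ.of_le h1le
  have hddσ1 : ContDiff ℝ 1 (partialD 1 (partialD 1 σ)) := (contDiff_partialD hdσ 1).of_le h1le
  set ℓ : ℝ → ℝ := fun s => M * (s + a) with hℓ
  have hℓ1 : ContDiff ℝ 1 ℓ := contDiff_length
  have ht := (h.tsupport_shiftAverage bumpKernel hσ.hasCompactSupport hσ.tsupport_subset).2
  have hds : tsupport (partialD 1 σ) ⊆ tsupport σ := tsupport_partialD_subset σ 1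
  have ht1 := (h.tsupport_shiftAverage bumpKernel
    (hσ.hasCompactSupport.of_isClosed_subset (isClosed_tsupport _) hds)
    (hds.trans hσ.tsupport_subset)).2
  have hz : ∀ {f : ℝ × ℝ → ℝ}, tsupport f ⊆ Ioo 0 s₀ ×ˢ Ioo (1 / 8 : ℝ) (3 / 4) →
      ∀ s, f (s, 0) = 0 ∧ f (s, 1) = 0 := fun hf s =>
    ⟨image_eq_zero_of_notMem_tsupport fun hx => by have := (hf hx).2.1; norm_num at this,
      image_eq_zero_of_notMem_tsupport fun hx => by have := (hf hx).2.2; norm_num at this⟩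
  have hk0 : bumpKernel 0 = 0 := by norm_num [bumpKernel]
  have hk1 : bumpKernel 1 = 0 := by norm_num [bumpKernel]
  have hk0' : bumpKernelDeriv 0 = 0 := by norm_num [bumpKernelDeriv]
  have hk1' : bumpKernelDeriv 1 = 0 := by norm_num [bumpKernelDeriv]
  have hM := h.one_le
  have ha := h.pos
  have hbd : ∀ {κ κ' : ℝ → ℝ} {f : ℝ × ℝ → ℝ} {s y B : ℝ}, (∀ τ, HasDerivAt κ (κ' τ) τ) →
      Continuous κ' → κ 0 = 0 → κ 1 = 0 → ContDiff ℝ 1 f → 0 < s →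
      |shiftAverage κ' ℓ f (s, y)| ≤ B →
      |shiftAverage κ ℓ (partialD 1 f) (s, y)| ≤ B / (M * (s + a)) := by
    intro κ κ' f s y B hκ hκ' h0 h1 hf hs hB
    have e := mul_shiftAverage_partialD (ℓ := ℓ) hκ hκ' hf s y
    have hMs : 0 < M * (s + a) := by positivity
    rw [h0, h1, zero_mul, zero_mul, add_zero, sub_zero] at e
    rw [le_div_iff₀ hMs, mul_comm, ← abs_of_pos hMs, ← abs_mul]
    change |ℓ s * _| ≤ B
    rwa [e]
  refine ⟨shiftAverage bumpKernel ℓ σ, shiftAverage bumpKernel ℓ (partialD 1 σ),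
    shiftAverage bumpKernel ℓ (partialD 1 (partialD 1 σ)), rfl,
    contDiff_shiftAverage contDiff_bumpKernel hℓ1 hσ1,
    contDiff_shiftAverage contDiff_bumpKernel hℓ1 hdσ1,
    contDiff_shiftAverage contDiff_bumpKernel hℓ1 hddσ1,
    funext fun x => partialD_one_shiftAverage contDiff_bumpKernel hℓ1 hσ1 x,
    funext fun x => partialD_one_shiftAverage contDiff_bumpKernel hℓ1 hdσ1 x,
    fun s => ⟨(hz ht s).1, (hz ht s).2, (hz ht1 s).1, (hz ht1 s).2⟩,
    fun s y hs => abs_shiftAverage_bumpKernel_le (hσ.abs_le s hs) y, fun s y hs => ?_,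
    fun s y hs => ?_⟩
  · refine (hbd hasDerivAt_bumpKernel (contDiff_bumpKernelDeriv (n := 0)).continuous hk0 hk1 hσ1 hs
      (abs_shiftAverage_le (fun τ hτ => abs_bumpKernelDeriv_le hτ) (hσ.abs_le s hs) y)).trans_eq ?_
    field_simp
  · refine (hbd hasDerivAt_bumpKernel (contDiff_bumpKernelDeriv (n := 0)).continuous hk0 hk1 hdσ1 hs
      (hbd hasDerivAt_bumpKernelDeriv continuous_bumpKernelDeriv2 hk0' hk1' hσ1 hs
      (abs_shiftAverage_le (fun τ hτ => abs_bumpKernelDeriv2_le hτ) (hσ.abs_le s hs) y))).trans_eq ?_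
    field_simp

theorem abs_integral_trace_le {τ : ℝ → ℝ} {l c : ℝ} (hl : 0 ≤ l) (hτ : LipschitzByDuality l τ)
    {f : ℝ × ℝ → ℝ} (hf : ContDiff ℝ 1 f) (ha : 0 < a)
    (h0 : ∀ s, f (s, 0) = 0) (h1 : ∀ s, f (s, 1) = 0)
    (hb : ∀ s y, 0 < s → s ≤ 1 → |f (s, y)| ≤ c * (s + a)⁻¹) :
    |∫ y in Ioo (0:ℝ) 1, τ y * tailPrimitive (partialD 1 f) (0, y)| ≤
      l * (c * Real.log ((1 + a) / a)) := by
  have hV := contDiff_tailPrimitive hf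
  have hd := partialD_one_tailPrimitive hf
  have hdc : Continuous (tailPrimitive (partialD 1 f)) := hd ▸ continuous_partialD hV 1
  refine (hτ (fun y => tailPrimitive f (0, y)) (fun y => tailPrimitive (partialD 1 f) (0, y))
    (fun y => ?_) (hdc.comp (Continuous.prodMk_right 0)) (by simp [tailPrimitive, h0])
    (by simp [tailPrimitive, h1])).trans (mul_le_mul_of_nonneg_left ?_ hl)
  · rw [← hd]
    exact hasDerivAt_slice_snd (hV.differentiable one_ne_zero (0, y))
  · have := setIntegral_mono_on (μ := volume) (s := Ioo (0:ℝ) 1)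
      (f := fun y => |tailPrimitive f (0, y)|) (g := fun _ => c * Real.log ((1 + a) / a))
      ((hV.continuous.comp (Continuous.prodMk_right 0)).abs.integrableOn_unitInterval)
      (continuous_const.integrableOn_unitInterval) measurableSet_Ioo
      fun y _ => abs_tailPrimitive_zero_le ha fun s hs => hb s y hs.1 hs.2
    simpa using this

theorem abs_integral_mul_le {g ψ : ℝ × ℝ → ℝ} {c : ℝ} (ha : 0 < a)
    (hg : MemLp g 2 (volume.restrict unitSquare))
    (hb : ∀ s y, 0 < s → s < 1 → |ψ (s, y)| ≤ c * (s + a)⁻¹) :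
    |∫ x in unitSquare, g x * ψ x| ≤ c * ∫ x in unitSquare, |g x| * (x.1 + a)⁻¹ := by
  have hgi : Integrable g (volume.restrict unitSquare) := hg.integrable (by norm_num)
  have hint : IntegrableOn (fun x => |g x| * (x.1 + a)⁻¹) unitSquare := by
    refine (hgi.abs.mul_const a⁻¹).mono' (hgi.abs.1.mul (by fun_prop)) ?_
    filter_upwards [ae_restrict_mem measurableSet_unitSquare] with x hx
    have h0 : 0 < x.1 + a := by linarith [hx.1.1]
    rw [norm_mul, Real.norm_eq_abs, abs_abs, Real.norm_of_nonneg (inv_nonneg.2 h0.le)]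
    exact mul_le_mul_of_nonneg_left (inv_anti₀ ha (by linarith [hx.1.1])) (abs_nonneg _)
  rw [← integral_const_mul, ← Real.norm_eq_abs (∫ x in unitSquare, g x * ψ x)]
  refine norm_integral_le_of_norm_le (hint.const_mul c) ?_
  filter_upwards [ae_restrict_mem measurableSet_unitSquare] with x hx
  rw [norm_mul, Real.norm_eq_abs, Real.norm_eq_abs]
  calc |g x| * |ψ x| ≤ |g x| * (c * (x.1 + a)⁻¹) :=
        mul_le_mul_of_nonneg_left (hb x.1 x.2 hx.1.1 hx.1.2) (abs_nonneg _)
    _ = c * (|g x| * (x.1 + a)⁻¹) := by ring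

theorem WeightedTest.integral_mul_le_add (hσ : WeightedTest a s₀ σ) (h : LayerScales M a s₀)
    {g : ℝ × ℝ → ℝ} {V : ℝ} (hg : MemLp g 2 (volume.restrict unitSquare))
    (hV : ∀ Φ : ℝ × ℝ → ℝ, ContDiff ℝ 1 Φ → HasCompactSupport Φ → tsupport Φ ⊆ unitSquare →
      (∀ x, |Φ x| ≤ M) → ∫ x in unitSquare, g x * partialD 1 Φ x ≤ M * V) :
    ∫ x in unitSquare, g x * σ x ≤ M * V +
      ∫ x in unitSquare, g x * shiftAverage bumpKernel (fun s => M * (s + a)) σ x := by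
  obtain ⟨Φ, h1, h2, h3, h4, h5⟩ := hσ.exists_partialD_eq h
  obtain ⟨S, -, -, hS, hSc, -⟩ := hσ.exists_average h
  have := hV Φ h1 h2 h3 h4
  simp_rw [h5, mul_comm (g _)] at this
  rw [integral_sub_mul_of_memLp (hσ.contDiff.continuous.memLp_unitSquare 2)
    ((hS ▸ hSc.continuous).memLp_unitSquare 2) hg] at this
  simp_rw [mul_comm (g _)]
  linarith

/-- Upper bound for the weighted tangential derivative when the full gradient is controlled. -/
theorem WeightedTest.integral_mul_le_of_gradient (hσ : WeightedTest a s₀ σ)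
    (h : LayerScales M a s₀) {f g₀ g₁ : ℝ × ℝ → ℝ} {τ : ℝ → ℝ} {V l : ℝ}
    (hf : HasTracedGradient f g₀ g₁ τ) (hl : 0 ≤ l) (hτ : LipschitzByDuality l τ)
    (hV : ∀ Φ : ℝ × ℝ → ℝ, ContDiff ℝ 1 Φ → HasCompactSupport Φ → tsupport Φ ⊆ unitSquare →
      (∀ x, |Φ x| ≤ M) → ∫ x in unitSquare, g₁ x * partialD 1 Φ x ≤ M * V) :
    ∫ x in unitSquare, g₁ x * σ x ≤ M * V + l * Real.log ((1 + a) / a) +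
      60 / M * ∫ x in unitSquare, |g₀ x| * (x.1 + a)⁻¹ := by
  have h1 := hσ.integral_mul_le_add h hf.memLp_one hV
  obtain ⟨S, S₁, S₂, hS, hc, hc₁, hc₂, hd, hd₁, hz, hb, hb₁, hb₂⟩ := hσ.exists_average h
  have hM : 0 < M := by linarith [h.one_le]
  have h2 := hf.integral_one S hc (fun s => (hz s).1) (fun s => (hz s).2.1)
  rw [hd, hf.integral_mul_tail hc₁] at h2
  have h3 := abs_integral_trace_le (c := 1) hl hτ hc h.pos
    (fun s => (hz s).1) (fun s => (hz s).2.1) fun s y hs _ => by simpa using hb s y hs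
  have h4 := abs_integral_mul_le (ψ := tailPrimitive S₁) (c := 60 / M) h.pos hf.memLp_zero
    fun s y hs hs1 => by
      simpa using abs_tailPrimitive_le_pow (f := S₁) (y := y) 0 h.pos (by positivity)
        (fun r hr => hb₁ r y hr.1) ⟨hs.le, hs1.le⟩
  rw [hd, one_mul] at h3
  rw [← hS] at h1
  have h3' := neg_le_of_abs_le h3
  have h4' := neg_le_of_abs_le h4
  linarith

/-- Upper bound for the weighted tangential derivative of the tangential component when only the
symmetric part of the gradient is controlled. -/
theorem WeightedTest.integral_mul_le_of_strain (hσ : WeightedTest a s₀ σ)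
    (h : LayerScales M a s₀) {f g₀ g₁ f' g₀' g₁' : ℝ × ℝ → ℝ} {τ τ' : ℝ → ℝ} {V l : ℝ}
    (hf : HasTracedGradient f g₀ g₁ τ) (hf' : HasTracedGradient f' g₀' g₁' τ') (hl : 0 ≤ l)
    (hτ : LipschitzByDuality l τ) (hτ' : LipschitzByDuality l τ')
    (hV : ∀ Φ : ℝ × ℝ → ℝ, ContDiff ℝ 1 Φ → HasCompactSupport Φ → tsupport Φ ⊆ unitSquare →
      (∀ x, |Φ x| ≤ M) → ∫ x in unitSquare, g₁ x * partialD 1 Φ x ≤ M * V) :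
    ∫ x in unitSquare, g₁ x * σ x ≤ M * V + l * (1 + 60 / M) * Real.log ((1 + a) / a) +
      60 / M * (∫ x in unitSquare, |g₀ x + g₁' x| * (x.1 + a)⁻¹) +
      60 / M * ∫ x in unitSquare, |g₀' x| * (x.1 + a)⁻¹ := by
  have h1 := hσ.integral_mul_le_add h hf.memLp_one hV
  obtain ⟨S, S₁, S₂, hS, hc, hc₁, hc₂, hd, hd₁, hz, hb, hb₁, hb₂⟩ := hσ.exists_average h
  have hM : 0 < M := by linarith [h.one_le]
  have hM2 : 60 / M ^ 2 ≤ 60 / M :=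
    div_le_div_of_nonneg_left (by norm_num) hM (by nlinarith [h.one_le])
  have hZ := contDiff_tailPrimitive hc₁
  have hZd : partialD 1 (tailPrimitive S₁) = tailPrimitive S₂ := by
    rw [partialD_one_tailPrimitive hc₁, hd₁]
  have hW := contDiff_tailPrimitive hc₂
  have h2 := hf.integral_one S hc (fun s => (hz s).1) (fun s => (hz s).2.1)
  rw [hd, hf.integral_mul_tail hc₁] at h2
  have h5 := hf'.integral_one _ hZ (fun s => by simp [tailPrimitive, (hz _).2.2.1])
    (fun s => by simp [tailPrimitive, (hz _).2.2.2])
  rw [hZd, hf'.integral_mul_tail hW] at h5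
  have hsplit : ∫ x in unitSquare, (g₀ x + g₁' x) * tailPrimitive S₁ x =
      (∫ x in unitSquare, g₀ x * tailPrimitive S₁ x) +
        ∫ x in unitSquare, g₁' x * tailPrimitive S₁ x := by
    have hZ2 := hZ.continuous.memLp_unitSquare 2
    simp_rw [add_mul]
    exact integral_add (hf.memLp_zero.integrable_mul hZ2) (hf'.memLp_one.integrable_mul hZ2)
  have hZb : ∀ s y, 0 ≤ s → s ≤ 1 → |tailPrimitive S₁ (s, y)| ≤ 60 / M * (s + a)⁻¹ :=
    fun s y hs hs1 => by
      simpa using abs_tailPrimitive_le_pow (f := S₁) (y := y) 0 h.pos (by positivity)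
        (fun r hr => hb₁ r y hr.1) ⟨hs, hs1⟩
  have hWb : ∀ s y, 0 ≤ s → s ≤ 1 →
      |tailPrimitive S₂ (s, y)| ≤ 60 / M ^ 2 * ((s + a)⁻¹) ^ 2 := fun s y hs hs1 =>
    abs_tailPrimitive_le_pow (f := S₂) (y := y) 1 h.pos (by positivity)
      (fun r hr => hb₂ r y hr.1) ⟨hs, hs1⟩
  have h3 := abs_integral_trace_le (c := 1) hl hτ hc h.pos
    (fun s => (hz s).1) (fun s => (hz s).2.1) fun s y hs _ => by simpa using hb s y hs
  have h4 := abs_integral_mul_le (ψ := tailPrimitive S₁) (c := 60 / M) h.pos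
    (hf.memLp_zero.add hf'.memLp_one) fun s y hs hs1 => hZb s y hs.le hs1.le
  have h6 := abs_integral_trace_le (c := 60 / M) hl hτ' hZ h.pos
    (fun s => by simp [tailPrimitive, (hz _).2.2.1])
    (fun s => by simp [tailPrimitive, (hz _).2.2.2]) fun s y hs hs1 => hZb s y hs.le hs1
  have h7 := abs_integral_mul_le (ψ := tailPrimitive (tailPrimitive S₂)) (c := 60 / M) h.pos
    hf'.memLp_zero fun s y hs hs1 => by
      have h0 : 0 ≤ (s + a)⁻¹ := inv_nonneg.2 (by linarith [h.pos])
      refine le_trans ?_ (mul_le_mul_of_nonneg_right hM2 h0)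
      simpa using abs_tailPrimitive_le_pow (f := tailPrimitive S₂) (y := y) 0 h.pos (by positivity)
        (fun r hr => hWb r y hr.1.le hr.2) ⟨hs.le, hs1.le⟩
  rw [hd, one_mul] at h3
  rw [hZd] at h6
  rw [← hS] at h1
  simp only [Pi.add_apply] at h4
  have h3' := neg_le_of_abs_le h3
  have h4' := neg_le_of_abs_le h4
  have h6' := neg_le_of_abs_le h6
  have h7' := neg_le_of_abs_le h7
  have e : l * (1 + 60 / M) * Real.log ((1 + a) / a) = l * Real.log ((1 + a) / a) +
    l * (60 / M * Real.log ((1 + a) / a)) := by ring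
  rw [e]
  linarith

end

theorem integral_mul_partialD_le_totalVar {G : ℝ × ℝ → Mat2} (hG : totalVar G ≠ ⊤) {M : ℝ}
    (hM : 0 < M) (i : Fin 2) {Φ : ℝ × ℝ → ℝ} (hΦ : ContDiff ℝ 1 Φ) (hc : HasCompactSupport Φ)
    (hs : tsupport Φ ⊆ unitSquare) (hb : ∀ x, |Φ x| ≤ M) :
    ∫ x in unitSquare, G x i 1 * partialD 1 Φ x ≤ M * (totalVar G).toReal := by
  set Ψ : Fin 2 → Fin 2 → Fin 2 → ℝ × ℝ → ℝ := fun i' j' k' =>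
    if i' = i ∧ j' = 1 ∧ k' = 1 then fun x => M⁻¹ * Φ x else fun _ => 0 with hΨ
  have h1 : ∀ i' j' k', ContDiff ℝ 1 (Ψ i' j' k') ∧ HasCompactSupport (Ψ i' j' k') ∧
      tsupport (Ψ i' j' k') ⊆ unitSquare := by
    intro i' j' k'
    simp only [hΨ]
    split_ifs
    · have hss : tsupport (fun x => M⁻¹ * Φ x) ⊆ tsupport Φ :=
        closure_mono fun x hx hx' => hx (by simp [hx'])
      exact ⟨contDiff_const.mul hΦ, hc.of_isClosed_subset (isClosed_tsupport _) hss,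
        hss.trans hs⟩
    · have : tsupport (fun _ : ℝ × ℝ => (0:ℝ)) = ∅ := by rw [tsupport_eq_empty_iff]; rfl
      exact ⟨contDiff_const, by rw [HasCompactSupport, this]; exact isCompact_empty,
        by rw [this]; exact empty_subset _⟩
  have hb' : ∀ x, (M⁻¹ * Φ x) ^ 2 ≤ 1 := fun x => by
    rw [sq_le_one_iff_abs_le_one, abs_mul, abs_inv, abs_of_pos hM, inv_mul_le_one₀ hM]
    exact hb x
  have h2 : ∀ x, ∑ i', ∑ j', ∑ k', (Ψ i' j' k' x) ^ 2 ≤ 1 := by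
    intro x
    have := hb' x
    fin_cases i <;> simpa [hΨ, Fin.sum_univ_two] using this
  have h3 : ∀ x, ∑ i', ∑ j', ∑ k', G x i' j' * partialD k' (Ψ i' j' k') x =
      M⁻¹ * (G x i 1 * partialD 1 Φ x) := by
    intro x
    have e0 : ∀ k, partialD k (fun _ => (0:ℝ)) x = 0 := fun k => by simp [partialD]
    have e1 : partialD 1 (fun x => M⁻¹ * Φ x) x = M⁻¹ * partialD 1 Φ x := by
      simp [partialD, fderiv_const_mul (hΦ.differentiable one_ne_zero x)]
    fin_cases i <;> simp [hΨ, Fin.sum_univ_two, e0, e1] <;> ring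
  have h4 : ENNReal.ofReal (∫ x in unitSquare,
      ∑ i', ∑ j', ∑ k', G x i' j' * partialD k' (Ψ i' j' k') x) ≤ totalVar G := by
    unfold totalVar
    exact le_iSup_of_le Ψ (le_iSup_of_le h1 (le_iSup_of_le h2 le_rfl))
  simp_rw [h3] at h4
  rw [integral_const_mul, ENNReal.ofReal_le_iff_le_toReal hG, inv_mul_le_iff₀ hM] at h4
  exact h4

theorem exists_mem_sum_sq_eq_distWells_sq {𝒦 : Set Mat2} (hK : IsCompact 𝒦) (hne : 𝒦.Nonempty)
    (A : Mat2) : 0 ≤ distWells A 𝒦 ∧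
      ∃ K ∈ 𝒦, ∑ i, ∑ j, (A i j - K i j) ^ 2 = distWells A 𝒦 ^ 2 := by
  let _ : NormedAddCommGroup Mat2 := Matrix.frobeniusNormedAddCommGroup
  obtain ⟨K, hKm, hKd⟩ := IsCompact.exists_infDist_eq_dist hK hne A
  refine ⟨Metric.infDist_nonneg, K, hKm, ?_⟩
  have : distWells A 𝒦 = ‖A - K‖ := by rw [← dist_eq_norm, ← hKd]; rfl
  rw [this, Matrix.frobenius_norm_def, ← Real.rpow_natCast, ← Real.rpow_mul (by positivity)]
  norm_num [Finset.sum_nonneg, Matrix.sub_apply]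

theorem continuous_distWells (𝒦 : Set Mat2) : Continuous fun A => distWells A 𝒦 := by
  let _ : NormedAddCommGroup Mat2 := Matrix.frobeniusNormedAddCommGroup
  exact Metric.continuous_infDist_pt 𝒦

theorem aestronglyMeasurable_distWells {μ : Measure (ℝ × ℝ)} {A : ℝ × ℝ → Mat2}
    (hA : ∀ i j, AEStronglyMeasurable (fun x => A x i j) μ) (𝒦 : Set Mat2) :
    AEStronglyMeasurable (fun x => distWells (A x) 𝒦) μ := by
  have h1 : AEStronglyMeasurable A μ := by
    have : AEMeasurable (fun x => fun i j => A x i j) μ :=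
      aemeasurable_pi_lambda _ fun i => aemeasurable_pi_lambda _ fun j => (hA i j).aemeasurable
    exact this.aestronglyMeasurable
  exact (continuous_distWells 𝒦).comp_aestronglyMeasurable h1

theorem exists_bound_entries {𝒦 : Set Mat2} (hK : IsCompact 𝒦) :
    ∃ C : ℝ, 0 ≤ C ∧ ∀ K ∈ 𝒦, ∀ i j, |K i j| ≤ C := by
  have h : ∀ i j, ∃ C, ∀ K ∈ 𝒦, ‖K i j‖ ≤ C := fun i j =>
    hK.exists_bound_of_continuousOn (f := fun K : Mat2 => K i j) (by fun_prop)
  choose C hC using h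
  refine ⟨∑ i, ∑ j, |C i j|, by positivity, fun K hKm i j => ?_⟩
  calc |K i j| ≤ |C i j| := (hC i j K hKm).trans (le_abs_self _)
    _ ≤ ∑ j, |C i j| := Finset.single_le_sum (f := fun j => |C i j|) (fun _ _ => abs_nonneg _) (Finset.mem_univ j)
    _ ≤ _ := Finset.single_le_sum (f := fun i => ∑ j, |C i j|)
        (fun _ _ => Finset.sum_nonneg fun _ _ => abs_nonneg _) (Finset.mem_univ i)

/-! ### Weighted integrals -/

theorem integral_weight_unitSquare {a : ℝ} (ha : 0 < a) :
    IntegrableOn (fun x : ℝ × ℝ => (x.1 + a)⁻¹) unitSquare ∧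
    ∫ x in unitSquare, (x.1 + a)⁻¹ = Real.log ((1 + a) / a) := by
  have hi : IntegrableOn (fun x : ℝ × ℝ => (x.1 + a)⁻¹) unitSquare := by
    refine (integrable_const a⁻¹).mono' (by fun_prop) ?_
    filter_upwards [ae_restrict_mem measurableSet_unitSquare] with x hx
    have h0 : 0 < x.1 + a := by linarith [hx.1.1]
    rw [Real.norm_of_nonneg (inv_nonneg.2 h0.le)]
    exact inv_anti₀ ha (by linarith [hx.1.1])
  refine ⟨hi, ?_⟩
  rw [integral_unitSquare hi, ← integral_inv_add ha, intervalIntegral.integral_of_le zero_le_one,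
    integral_Ioc_eq_integral_Ioo]
  simp

theorem integral_weight_rectangle {a b : ℝ} (ha : 0 < a) (hab : a ≤ b) :
    ∫ x in Icc a b ×ˢ Icc (1 / 4 : ℝ) (1 / 2), (x.1 + a)⁻¹ =
      1 / 4 * Real.log ((b + a) / (2 * a)) := by
  rw [Measure.volume_eq_prod]
  have := setIntegral_prod_mul (μ := (volume : Measure ℝ)) (ν := (volume : Measure ℝ))
    (fun s : ℝ => (s + a)⁻¹) (fun _ : ℝ => (1:ℝ)) (Icc a b) (Icc (1 / 4 : ℝ) (1 / 2))
  simp only [mul_one] at this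
  rw [this, integral_Icc_eq_integral_Ioc, ← intervalIntegral.integral_of_le hab,
    intervalIntegral.integral_comp_add_right (fun s => s⁻¹),
    integral_inv_of_pos (by linarith) (by linarith)]
  rw [setIntegral_const, show a + a = 2 * a by ring]
  norm_num [Measure.real]
  ring

theorem integrableOn_mul_weight {a : ℝ} (ha : 0 < a) {q : ℝ × ℝ → ℝ}
    (hq : IntegrableOn q unitSquare) : IntegrableOn (fun x => q x * (x.1 + a)⁻¹) unitSquare := by
  refine (hq.abs.mul_const a⁻¹).mono' (hq.1.mul (by fun_prop)) ?_
  filter_upwards [ae_restrict_mem measurableSet_unitSquare] with x hx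
  have h0 : 0 < x.1 + a := by linarith [hx.1.1]
  rw [norm_mul, Real.norm_eq_abs, Real.norm_of_nonneg (inv_nonneg.2 h0.le)]
  exact mul_le_mul_of_nonneg_left (inv_anti₀ ha (by linarith [hx.1.1])) (abs_nonneg _)

theorem integral_mul_weight_le {a : ℝ} (ha : 0 < a) {q : ℝ × ℝ → ℝ} (hq0 : ∀ x, 0 ≤ q x)
    (hq : IntegrableOn q unitSquare) {s : Set (ℝ × ℝ)} (hs : s ⊆ unitSquare) :
    ∫ x in s, q x * (x.1 + a)⁻¹ ≤ (∫ x in unitSquare, q x) / a := by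
  have hi := integrableOn_mul_weight ha hq
  have hnn : 0 ≤ᵐ[volume.restrict unitSquare] fun x => q x * (x.1 + a)⁻¹ := by
    filter_upwards [ae_restrict_mem measurableSet_unitSquare] with x hx
    exact mul_nonneg (hq0 x) (inv_nonneg.2 (by linarith [hx.1.1]))
  refine (setIntegral_mono_set hi hnn hs.eventuallyLE).trans ?_
  rw [div_eq_mul_inv, ← integral_mul_const]
  refine integral_mono_ae hi (hq.mul_const _) ?_
  filter_upwards [ae_restrict_mem measurableSet_unitSquare] with x hx
  exact mul_le_mul_of_nonneg_left (inv_anti₀ ha (by linarith [hx.1.1])) (hq0 x)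

theorem integral_abs_mul_weight_le {a C : ℝ} (ha : 0 < a) {g q : ℝ × ℝ → ℝ} (hq0 : ∀ x, 0 ≤ q x)
    (hq : IntegrableOn q unitSquare) (hg : MemLp g 2 (volume.restrict unitSquare))
    (h : ∀ x, |g x| ≤ C + q x) :
    ∫ x in unitSquare, |g x| * (x.1 + a)⁻¹ ≤
      C * Real.log ((1 + a) / a) + (∫ x in unitSquare, q x) / a := by
  obtain ⟨hi, he⟩ := integral_weight_unitSquare ha
  have hgi : IntegrableOn g unitSquare := hg.integrable (by norm_num)
  have h1 := integral_mul_weight_le ha hq0 hq subset_rfl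
  calc ∫ x in unitSquare, |g x| * (x.1 + a)⁻¹
      ≤ ∫ x in unitSquare, (C * (x.1 + a)⁻¹ + q x * (x.1 + a)⁻¹) := by
        refine integral_mono_ae (integrableOn_mul_weight ha hgi.abs)
          ((hi.const_mul C).add (integrableOn_mul_weight ha hq)) ?_
        filter_upwards [ae_restrict_mem measurableSet_unitSquare] with x hx
        have h0 : 0 ≤ (x.1 + a)⁻¹ := inv_nonneg.2 (by linarith [hx.1.1])
        have := mul_le_mul_of_nonneg_right (h x) h0
        linarith
    _ = C * Real.log ((1 + a) / a) + ∫ x in unitSquare, q x * (x.1 + a)⁻¹ := by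
        rw [integral_add (hi.const_mul C) (integrableOn_mul_weight ha hq), integral_const_mul, he]
    _ ≤ _ := by linarith

theorem le_integral_mul_weight {a b c δ : ℝ} (ha : 0 < a) (hab : a ≤ b) (hb : b < 1) (hc : 0 ≤ c)
    {g q : ℝ × ℝ → ℝ} (hq0 : ∀ x, 0 ≤ q x)
    (hq : IntegrableOn q unitSquare) (hg : IntegrableOn g unitSquare)
    (h : ∀ x, δ ≤ g x + c * q x) :
    δ / 4 * Real.log ((b + a) / (2 * a)) ≤
      (∫ x in Icc a b ×ˢ Icc (1 / 4 : ℝ) (1 / 2), g x * (x.1 + a)⁻¹) +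
        c * ((∫ x in unitSquare, q x) / a) := by
  set R : Set (ℝ × ℝ) := Icc a b ×ˢ Icc (1 / 4 : ℝ) (1 / 2) with hR
  have hRQ : R ⊆ unitSquare := fun x hx =>
    ⟨⟨ha.trans_le hx.1.1, hx.1.2.trans_lt hb⟩, by linarith [hx.2.1], by linarith [hx.2.2]⟩
  have hRm : MeasurableSet R := measurableSet_Icc.prod measurableSet_Icc
  have hi := (integral_weight_unitSquare ha).1.mono_set hRQ
  have h1 := integral_mul_weight_le ha hq0 hq hRQ
  have hgi := (integrableOn_mul_weight ha hg).mono_set hRQ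
  have hqi := (integrableOn_mul_weight ha hq).mono_set hRQ
  have h2 : ∫ x in R, δ * (x.1 + a)⁻¹ ≤
      ∫ x in R, (g x * (x.1 + a)⁻¹ + c * (q x * (x.1 + a)⁻¹)) := by
    refine setIntegral_mono_on (hi.const_mul δ) (hgi.add (hqi.const_mul c)) hRm fun x hx => ?_
    have h0 : 0 ≤ (x.1 + a)⁻¹ := inv_nonneg.2 (by linarith [(hRQ hx).1.1])
    have := mul_le_mul_of_nonneg_right (h x) h0
    linarith
  rw [integral_const_mul, integral_weight_rectangle ha hab, integral_add hgi (hqi.const_mul c),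
    integral_const_mul] at h2
  have h3 := mul_le_mul_of_nonneg_left h1 hc
  linarith

theorem log_layer_bounds {s₀ a x : ℝ} (hs₀0 : 0 < s₀) (hs₀1 : s₀ < 1) (hx0 : 0 ≤ x)
    (ha : a = (s₀ / 8) ^ 4 * Real.exp (-x / 2)) (ha1 : a ≤ 1) :
    3 / 4 * Real.log ((1 + a) / a) ≤ Real.log ((s₀ / 2 + a) / (2 * a)) ∧
      (x + 1) / 2 ≤ Real.log ((1 + a) / a) ∧ 1 ≤ Real.log ((1 + a) / a) := by
  have ha0 : 0 < a := by rw [ha]; positivity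
  have hloga : Real.log a = 4 * (Real.log s₀ - Real.log 8) - x / 2 := by
    rw [ha, Real.log_mul (by positivity) (Real.exp_pos _).ne', Real.log_exp, Real.log_pow,
      Real.log_div hs₀0.ne' (by norm_num)]
    push_cast; ring
  have hlog2 : (1:ℝ) / 2 < Real.log 2 := by linarith [Real.log_two_gt_d9]
  have hlog4 : Real.log 4 = 2 * Real.log 2 := by
    rw [show (4:ℝ) = 2 ^ 2 by norm_num, Real.log_pow]; norm_num
  have hlog8 : Real.log 8 = 3 * Real.log 2 := by
    rw [show (8:ℝ) = 2 ^ 3 by norm_num, Real.log_pow]; norm_num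
  have hlogs : Real.log s₀ ≤ 0 := Real.log_nonpos hs₀0.le hs₀1.le
  have hle : Real.log ((1 + a) / a) ≤ Real.log 2 - Real.log a := by
    rw [Real.log_div (by linarith) ha0.ne']
    have : Real.log (1 + a) ≤ Real.log 2 := Real.log_le_log (by linarith) (by linarith)
    linarith
  have hge : -Real.log a ≤ Real.log ((1 + a) / a) := by
    rw [Real.log_div (by linarith) ha0.ne']
    have : 0 ≤ Real.log (1 + a) := Real.log_nonneg (by linarith)
    linarith
  have hlow : Real.log s₀ - Real.log 4 - Real.log a ≤ Real.log ((s₀ / 2 + a) / (2 * a)) := by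
    rw [← Real.log_div hs₀0.ne' (by norm_num), ← Real.log_div (by positivity) ha0.ne']
    refine Real.log_le_log (by positivity) ?_
    rw [div_le_div_iff₀ ha0 (by positivity)]
    nlinarith
  refine ⟨?_, ?_, ?_⟩ <;> linarith

theorem variation_lower_bound {d C M V L L' e : ℝ} (hd : 0 < d) (hM : 600 ≤ M)
    (hMC : 36000 * C ≤ M * d) (hL : 1 ≤ L) (hLL : 3 / 4 * L ≤ L') (he : 0 ≤ e)
    (hed : (1 / d + 1) * e ≤ d / 100)
    (h : 3 * d / 16 * L' ≤ 2 * M * V + 2 * (d / 104) * (1 + 60 / M) * L +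
      360 / M * (C * L + e) + 1 / d * e) : 8 / 100 * (d * L) ≤ 2 * M * V := by
  have hM0 : 0 < M := by linarith
  have h60 : 60 / M ≤ 1 / 10 := by rw [div_le_div_iff₀ hM0 (by norm_num)]; linarith
  have h360 : 360 / M ≤ 1 := by rw [div_le_one hM0]; linarith
  have hCM : 360 / M * C ≤ d / 100 := by
    rw [div_mul_eq_mul_div, div_le_div_iff₀ hM0 (by norm_num)]; linarith
  have e1 : 3 * d / 16 * (3 / 4 * L) ≤ 3 * d / 16 * L' :=
    mul_le_mul_of_nonneg_left hLL (by positivity)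
  have e2 : d * L * (60 / M) ≤ d * L * (1 / 10) :=
    mul_le_mul_of_nonneg_left h60 (by positivity)
  have e3 := mul_le_mul_of_nonneg_right h360 he
  have e4 := mul_le_mul_of_nonneg_right hCM (by linarith : 0 ≤ L)
  have e5 : d ≤ d * L := le_mul_of_one_le_right hd.le hL
  linarith

theorem exists_scaling_constant {d C : ℝ} (hd : 0 < d) (hC : 0 ≤ C) :
    ∃ c : ℝ, 0 < c ∧ ∀ E V : ℝ, 0 ≤ E → 0 ≤ V →
      (∀ M a s₀ : ℝ, LayerScales M a s₀ → a ≤ s₀ / 2 →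
        3 * d / 16 * Real.log ((s₀ / 2 + a) / (2 * a)) ≤
          2 * M * V + 2 * (d / 104) * (1 + 60 / M) * Real.log ((1 + a) / a) +
          360 / M * (C * Real.log ((1 + a) / a) + E / a) + 1 / d * (E / a)) →
      ∀ ε : ℝ, 0 < ε → c * min 1 (ε * (|Real.log ε| + 1)) ≤ E + ε * V := by
  obtain ⟨M, hM600, hMC⟩ : ∃ M : ℝ, 600 ≤ M ∧ 36000 * C ≤ M * d := by
    refine ⟨600 + 36000 * C / d, ?_, ?_⟩
    · have : 0 ≤ 36000 * C / d := by positivity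
      linarith
    · rw [add_mul, div_mul_cancel₀ _ hd.ne']
      linarith
  have hM0 : 0 < M := by linarith
  obtain ⟨s₀, hs₀0, hs₀M⟩ : ∃ s₀ : ℝ, 0 < s₀ ∧ M * s₀ = 1 / 16 :=
    ⟨1 / (16 * M), by positivity, by field_simp⟩
  have hs₀1 : s₀ < 1 := by nlinarith
  obtain ⟨a₀, ha₀⟩ : ∃ a₀ : ℝ, a₀ = (s₀ / 8) ^ 4 := ⟨_, rfl⟩
  have ha₀0 : 0 < a₀ := by rw [ha₀]; positivity
  have ha₀s : a₀ ≤ s₀ / 8 := by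
    rw [ha₀]
    exact pow_le_of_le_one (by positivity) (by linarith) (by norm_num)
  obtain ⟨c₁, hc₁0, hc₁⟩ : ∃ c₁ : ℝ, 0 < c₁ ∧ (1 / d + 1) * c₁ = d / 100 :=
    ⟨d / 100 / (1 / d + 1), by positivity, by field_simp⟩
  obtain ⟨c, hc0, hcM, hca⟩ : ∃ c : ℝ, 0 < c ∧ c ≤ d / (50 * M) ∧ c ≤ c₁ * a₀ / 2 :=
    ⟨min (d / (50 * M)) (c₁ * a₀ / 2), by positivity, min_le_left _ _, min_le_right _ _⟩
  refine ⟨c, hc0, fun E V hE hV h => ?_⟩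
  have key : ∀ ε : ℝ, 0 < ε → ε ≤ 1 → c * (ε * (|Real.log ε| + 1)) ≤ E + ε * V := by
    intro ε hε hε1
    have hεV : 0 ≤ ε * V := mul_nonneg hε.le hV
    obtain ⟨x, hxdef⟩ : ∃ x, x = -Real.log ε := ⟨_, rfl⟩
    have hx : |Real.log ε| = x := hxdef ▸ abs_of_nonpos (Real.log_nonpos hε.le hε1)
    have hx0 : 0 ≤ x := hx ▸ abs_nonneg _
    rw [hx]
    obtain ⟨r, hr⟩ : ∃ r, r = Real.exp (-x / 2) := ⟨_, rfl⟩
    have hr0 : 0 < r := hr ▸ Real.exp_pos _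
    have hr1 : r ≤ 1 := hr ▸ Real.exp_le_one_iff.2 (by linarith)
    have hrε : r * r = ε := by
      rw [hr, ← Real.exp_add, show -x / 2 + -x / 2 = Real.log ε by rw [hxdef]; ring,
        Real.exp_log hε]
    have hrx : r * (x + 1) ≤ 2 := by
      have h1 : x / 2 + 1 ≤ Real.exp (x / 2) := Real.add_one_le_exp _
      have h2 : r * Real.exp (x / 2) = 1 := by
        rw [hr, ← Real.exp_add, show -x / 2 + x / 2 = 0 by ring, Real.exp_zero]
      have h3 := mul_le_mul_of_nonneg_left h1 hr0.le
      linarith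
    obtain ⟨a, ha⟩ : ∃ a, a = a₀ * r := ⟨_, rfl⟩
    have ha0 : 0 < a := by rw [ha]; positivity
    have haa : a ≤ a₀ := ha ▸ mul_le_of_le_one_right ha₀0.le hr1
    have hε0 : 0 ≤ ε * (x + 1) := by positivity
    rcases le_or_gt E (c₁ * a) with hEa | hEa
    · have hMa : M * a ≤ M * s₀ := mul_le_mul_of_nonneg_left (by linarith) hM0.le
      have hin := h M a s₀ ⟨by linarith, ha0, hs₀0, by linarith⟩ (by linarith)
      obtain ⟨h1, h2, h3⟩ := log_layer_bounds (a := a) hs₀0 hs₀1 hx0 (by rw [ha, ha₀, hr]) (by linarith)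
      have hEa' : (1 / d + 1) * (E / a) ≤ d / 100 := by
        rw [← hc₁]
        exact mul_le_mul_of_nonneg_left ((div_le_iff₀ ha0).2 hEa) (by positivity)
      have h4 := variation_lower_bound hd hM600 hMC h3 h1 (by positivity) hEa' hin
      have h5 := mul_le_mul_of_nonneg_left h2 hd.le
      have h6 : d / (50 * M) * (x + 1) ≤ V := by
        rw [div_mul_eq_mul_div, div_le_iff₀ (by positivity)]
        linarith
      calc c * (ε * (x + 1)) ≤ d / (50 * M) * (ε * (x + 1)) := mul_le_mul_of_nonneg_right hcM hε0
        _ = ε * (d / (50 * M) * (x + 1)) := by ring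
        _ ≤ ε * V := mul_le_mul_of_nonneg_left h6 hε.le
        _ ≤ E + ε * V := by linarith
    · calc c * (ε * (x + 1)) ≤ c₁ * a₀ / 2 * (ε * (x + 1)) := mul_le_mul_of_nonneg_right hca hε0
        _ = c₁ * a / 2 * (r * (x + 1)) := by rw [← hrε, ha]; ring
        _ ≤ c₁ * a / 2 * 2 := mul_le_mul_of_nonneg_left hrx (by positivity)
        _ ≤ E + ε * V := by linarith
  intro ε hε
  rcases le_or_gt ε 1 with hε1 | hε1
  · exact (mul_le_mul_of_nonneg_left (min_le_right _ _) hc0.le).trans (key ε hε hε1)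
  · have h1 := key 1 one_pos le_rfl
    simp only [Real.log_one, abs_zero, zero_add, mul_one, one_mul] at h1
    have h2 := mul_le_mul_of_nonneg_left (min_le_left 1 (ε * (|Real.log ε| + 1))) hc0.le
    have h3 : V ≤ ε * V := le_mul_of_one_le_left hV hε1.le
    linarith

theorem ofReal_le_energy {q : ℝ × ℝ → ℝ} {TV : ℝ≥0∞} {ε m : ℝ} (hε : 0 < ε)
    (hqm : AEStronglyMeasurable q (volume.restrict unitSquare)) (hq0 : ∀ x, 0 ≤ q x)
    (h : IntegrableOn q unitSquare → TV ≠ ⊤ → m ≤ (∫ x in unitSquare, q x) + ε * TV.toReal) :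
    ENNReal.ofReal m ≤ (∫⁻ x in unitSquare, ENNReal.ofReal (q x)) + ENNReal.ofReal ε * TV := by
  by_cases hTV : TV = ⊤
  · rw [hTV, ENNReal.mul_top (ENNReal.ofReal_pos.2 hε).ne', add_top]
    exact le_top
  by_cases hq : (∫⁻ x in unitSquare, ENNReal.ofReal (q x)) = ⊤
  · rw [hq, top_add]; exact le_top
  have hqi : IntegrableOn q unitSquare :=
    (lintegral_ofReal_ne_top_iff_integrable hqm (Eventually.of_forall hq0)).1 hq
  rw [← ofReal_integral_eq_lintegral_ofReal hqi (Eventually.of_forall hq0)]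
  rw [show ENNReal.ofReal ε * TV = ENNReal.ofReal (ε * TV.toReal) by
    rw [ENNReal.ofReal_mul hε.le, ENNReal.ofReal_toReal hTV], ← ENNReal.ofReal_add (integral_nonneg hq0)
    (mul_nonneg hε.le ENNReal.toReal_nonneg)]
  exact ENNReal.ofReal_le_ofReal (h hqi hTV)

theorem LayerScales.integral_rectangle_le {M a s₀ B : ℝ} (h : LayerScales M a s₀)
    {g : ℝ × ℝ → ℝ} (hg : MemLp g 2 (volume.restrict unitSquare))
    (hB : ∀ σ, WeightedTest a s₀ σ → ∫ x in unitSquare, g x * σ x ≤ B) :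
    ∫ x in Icc a (s₀ / 2) ×ˢ Icc (1 / 4 : ℝ) (1 / 2), |g x| * (x.1 + a)⁻¹ ≤ B := by
  have ha := h.pos
  have hs := h.s₀_pos
  have hs1 := h.s₀_lt
  refine setIntegral_abs_mul_le_of_forall (U := Ioo 0 s₀ ×ˢ Ioo (1 / 8 : ℝ) (5 / 8)) (C := a⁻¹)
    (isCompact_Icc.prod isCompact_Icc) (isOpen_Ioo.prod isOpen_Ioo) ?_ ?_ hg ?_ ?_ ?_ ?_
  · rintro x ⟨h1, h2⟩
    exact ⟨⟨ha.trans_le h1.1, by linarith [h1.2]⟩, by linarith [h2.1], by linarith [h2.2]⟩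
  · rintro x ⟨h1, h2⟩
    exact ⟨⟨h1.1, h1.2.trans hs1⟩, by linarith [h2.1], by linarith [h2.2]⟩
  · exact (contDiff_fst.add contDiff_const).contDiffOn.inv fun x hx => by
      have : 0 < x.1 + a := by linarith [hx.1.1]
      exact this.ne'
  · exact fun x hx => inv_nonneg.2 (by linarith [hx.1.1])
  · exact fun x hx => inv_anti₀ ha (by linarith [hx.1.1])
  · intro σ h1 h2 h3 h4
    refine hB σ ⟨h1, h2, h3, fun s hs0 y => ?_⟩
    by_cases hx : (s, y) ∈ tsupport σ
    · obtain ⟨h5, h6⟩ := h3 hx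
      exact h4 (s, y) ⟨⟨h5.1, h5.2.trans hs1⟩, by linarith [h6.1], by linarith [h6.2]⟩
    · rw [image_eq_zero_of_notMem_tsupport hx, abs_zero]
      exact inv_nonneg.2 (by linarith)

theorem le_quarter_add_sq_div {d D : ℝ} (hd : 0 < d) : D ≤ d / 4 + 1 / d * D ^ 2 := by
  have : d / 4 + 1 / d * D ^ 2 - D = (D - d / 2) ^ 2 / d := by field_simp; ring
  have h2 : 0 ≤ (D - d / 2) ^ 2 / d := by positivity
  linarith

theorem abs_entry_le {𝒦 : Set Mat2} (hK : IsCompact 𝒦) (hne : 𝒦.Nonempty) {C : ℝ}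
    (hC : ∀ K ∈ 𝒦, ∀ i j, |K i j| ≤ C) (A : Mat2) (i j : Fin 2) :
    |A i j| ≤ (C + 1) + distWells A 𝒦 ^ 2 := by
  obtain ⟨h0, K, hKm, hs⟩ := exists_mem_sum_sq_eq_distWells_sq hK hne A
  have h1 : (A i j - K i j) ^ 2 ≤ distWells A 𝒦 ^ 2 := by
    rw [← hs]
    refine (Finset.single_le_sum (f := fun j => (A i j - K i j) ^ 2)
      (fun _ _ => sq_nonneg _) (Finset.mem_univ j)).trans ?_
    exact Finset.single_le_sum (f := fun i => ∑ j, (A i j - K i j) ^ 2)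
      (fun _ _ => Finset.sum_nonneg fun _ _ => sq_nonneg _) (Finset.mem_univ i)
  have h2 := abs_le_of_sq_le_sq h1 h0
  have h3 : |A i j| ≤ |K i j| + |A i j - K i j| := by
    have := abs_add_le (K i j) (A i j - K i j)
    rwa [add_sub_cancel] at this
  have h4 := hC K hKm i j
  have h5 : |A i j - K i j| ≤ distWells A 𝒦 := h2
  nlinarith [sq_nonneg (distWells A 𝒦 - 1)]

theorem le_abs_column_add {𝒦 : Set Mat2} (hK : IsCompact 𝒦) (hne : 𝒦.Nonempty) {d : ℝ}
    (hd : 0 < d) (hdK : ∀ K ∈ 𝒦, d ≤ ‖mulVec2 K e2 - e2‖) (A : Mat2) :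
    3 * d / 4 ≤ (|A 0 1 - e2 0| + |A 1 1 - e2 1|) + 1 / d * distWells A 𝒦 ^ 2 := by
  obtain ⟨h0, K, hKm, hs⟩ := exists_mem_sum_sq_eq_distWells_sq hK hne A
  have h1 := hdK K hKm
  have hw : ‖mulVec2 A e2 - e2‖ ≤ |A 0 1 - e2 0| + |A 1 1 - e2 1| := by
    rw [EuclideanSpace.norm_eq]
    refine Real.sqrt_le_iff.2 ⟨by positivity, ?_⟩
    simp only [Fin.sum_univ_two, mulVec2, e2, Matrix.mulVec, dotProduct, PiLp.sub_apply,
      Real.norm_eq_abs, sq_abs]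
    simp
    nlinarith [sq_abs (A 0 1), sq_abs (A 1 1 - 1),
      mul_nonneg (abs_nonneg (A 0 1)) (abs_nonneg (A 1 1 - 1))]
  have hz : ‖(mulVec2 K e2 - e2) - (mulVec2 A e2 - e2)‖ ≤ distWells A 𝒦 := by
    rw [EuclideanSpace.norm_eq]
    refine Real.sqrt_le_iff.2 ⟨h0, ?_⟩
    rw [← hs]
    simp only [Fin.sum_univ_two, mulVec2, e2, Matrix.mulVec, dotProduct, PiLp.sub_apply,
      Real.norm_eq_abs, sq_abs]
    simp
    nlinarith [sq_nonneg (A 0 0 - K 0 0), sq_nonneg (A 1 0 - K 1 0)]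
  have h2 := norm_sub_norm_le (mulVec2 K e2 - e2) (mulVec2 A e2 - e2)
  have h3 := le_quarter_add_sq_div (D := distWells A 𝒦) hd
  linarith

theorem le_abs_diag_add {𝒦 : Set Mat2} (hK : IsCompact 𝒦) (hne : 𝒦.Nonempty) {d : ℝ}
    (hd : 0 < d) (hdK : ∀ K ∈ 𝒦, d ≤ |K 1 1|) (A : Mat2) :
    3 * d / 4 ≤ |A 1 1| + 1 / d * distWells A 𝒦 ^ 2 := by
  obtain ⟨h0, K, hKm, hs⟩ := exists_mem_sum_sq_eq_distWells_sq hK hne A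
  have h1 := hdK K hKm
  have hz : |A 1 1 - K 1 1| ≤ distWells A 𝒦 := by
    refine abs_le_of_sq_le_sq ?_ h0
    rw [← hs]
    simp only [Fin.sum_univ_two]
    nlinarith [sq_nonneg (A 0 0 - K 0 0), sq_nonneg (A 1 0 - K 1 0), sq_nonneg (A 0 1 - K 0 1)]
  have h2 := abs_sub_abs_le_abs_sub (K 1 1) (A 1 1)
  rw [abs_sub_comm] at h2
  have h3 := le_quarter_add_sq_div (D := distWells A 𝒦) hd
  linarith

theorem toLp_zero_apply (y : ℝ) (i : Fin 2) : (!₂[0, y] : Vec2) i = e2 i * y := by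
  fin_cases i <;> simp [e2]

theorem integral_sub_const_mul_partialD {G : ℝ × ℝ → ℝ} (β : ℝ)
    (hG : MemLp G 2 (volume.restrict unitSquare)) {Φ : ℝ × ℝ → ℝ} (hΦ : ContDiff ℝ 1 Φ)
    (hs : tsupport Φ ⊆ unitSquare) :
    ∫ x in unitSquare, (G x - β) * partialD 1 Φ x = ∫ x in unitSquare, G x * partialD 1 Φ x := by
  have hz : ∀ x, x ∉ unitSquare → Φ x = 0 := fun x hx =>
    image_eq_zero_of_notMem_tsupport fun h => hx (hs h)
  rw [integral_sub_mul_of_memLp hG (memLp_const β)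
    ((continuous_partialD hΦ 1).memLp_unitSquare 2), integral_const_mul,
    integral_partialD_one_eq_zero hΦ (fun s => hz _ fun h => lt_irrefl _ h.2.1)
      (fun s => hz _ fun h => lt_irrefl _ h.2.2)]
  ring

theorem nonlinearEnergy_lower_bound {𝒦 : Set Mat2} (hK : IsCompact 𝒦) {d : ℝ}
    (hd : IsLeast ((fun K => ‖mulVec2 K e2 - e2‖) '' 𝒦) d) (hd0 : 0 < d) :
    ∃ c : ℝ, 0 < c ∧
      ∀ (u : ℝ × ℝ → Vec2) (T : ℝ → Vec2), MemW12 u → IsLeftTrace u T →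
        (∀ a b : ℝ, 0 ≤ a → a < b → b ≤ 1 →
          essOsc (fun y => T y - !₂[0, y]) (Ioo a b) ≤ ENNReal.ofReal (d / 104 * (b - a))) →
        ∀ ε : ℝ, 0 < ε →
          ENNReal.ofReal (c * min 1 (ε * (|Real.log ε| + 1))) ≤ nonlinearEnergy 𝒦 ε u := by
  have hne : 𝒦.Nonempty := hd.1.imp fun _ h => h.1
  have hdK : ∀ K ∈ 𝒦, d ≤ ‖mulVec2 K e2 - e2‖ := fun K hKm => hd.2 ⟨K, hKm, rfl⟩
  obtain ⟨C, hC0, hC⟩ := exists_bound_entries hK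
  obtain ⟨c, hc, hmain⟩ := exists_scaling_constant hd0 (by linarith : 0 ≤ C + 1)
  refine ⟨c, hc, fun u T hu hT hosc ε hε => ?_⟩
  have hGm := hu.isL2WeakGradient.memLp
  refine ofReal_le_energy hε
    ((aestronglyMeasurable_distWells (fun i j => (hGm i j).1) 𝒦).pow 2)
    (fun x => sq_nonneg _) fun hq hTV => ?_
  set q : ℝ × ℝ → ℝ := fun x => distWells (weakGrad u x) 𝒦 ^ 2 with hqdef
  have hq0 : ∀ x, 0 ≤ q x := fun x => sq_nonneg _
  refine hmain _ _ (integral_nonneg hq0) ENNReal.toReal_nonneg (fun M a s₀ h has => ?_) ε hε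
  have hM : 0 < M := by linarith [h.one_le]
  have ha := h.pos
  set Λ : ℝ := Real.log ((1 + a) / a) with hΛ
  set E : ℝ := ∫ x in unitSquare, q x with hE
  set V : ℝ := (totalVar (weakGrad u)).toReal with hV
  have htr : ∀ i, HasTracedGradient (fun x => u x i - e2 i * x.2) (fun x => weakGrad u x i 0)
      (fun x => weakGrad u x i 1 - e2 i) fun y => T y i - e2 i * y := fun i =>
    (hT.hasTracedGradient hu i).sub_linear (e2 i)
  have hlip : ∀ i, LipschitzByDuality (d / 104) fun y => T y i - e2 i * y := fun i => by
    have e : (fun y => T y i - e2 i * y) = fun y => (T y - !₂[0, y]) i :=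
      funext fun y => by rw [PiLp.sub_apply, toLp_zero_apply]
    rw [e]
    exact lipschitzByDuality_of_essOsc_le hosc (by positivity) i
  have hup : ∀ i, ∫ x in Icc a (s₀ / 2) ×ˢ Icc (1 / 4 : ℝ) (1 / 2),
      |weakGrad u x i 1 - e2 i| * (x.1 + a)⁻¹ ≤
        M * V + d / 104 * Λ + 60 / M * ((C + 1) * Λ + E / a) := fun i => by
    have h1 := integral_abs_mul_weight_le ha hq0 hq (hGm i 0)
      fun x => abs_entry_le hK hne hC (weakGrad u x) i 0
    refine h.integral_rectangle_le (htr i).memLp_one fun σ hσ => ?_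
    refine (hσ.integral_mul_le_of_gradient (V := V) h (htr i) (by positivity) (hlip i)
      fun Φ h2 h3 h4 h5 => ?_).trans ?_
    · rw [integral_sub_const_mul_partialD _ (hGm i 1) h2 h4]
      exact integral_mul_partialD_le_totalVar hTV hM i h2 h3 h4 h5
    · gcongr
  have hgi : ∀ i, IntegrableOn (fun x => |weakGrad u x i 1 - e2 i|) unitSquare := fun i =>
    ((htr i).memLp_one.integrable (by norm_num)).abs
  have hlow := le_integral_mul_weight (b := s₀ / 2) (c := 1 / d) ha has (by linarith [h.s₀_lt, h.s₀_pos])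
    (by positivity) hq0 hq ((hgi 0).add (hgi 1))
    fun x => le_abs_column_add hK hne hd0 hdK (weakGrad u x)
  have hRQ : Icc a (s₀ / 2) ×ˢ Icc (1 / 4 : ℝ) (1 / 2) ⊆ unitSquare := fun x hx =>
    ⟨⟨ha.trans_le hx.1.1, by linarith [hx.1.2, h.s₀_lt, h.s₀_pos]⟩, by linarith [hx.2.1],
      by linarith [hx.2.2]⟩
  simp only [Pi.add_apply, add_mul] at hlow
  rw [integral_add ((integrableOn_mul_weight ha (hgi 0)).mono_set hRQ)
    ((integrableOn_mul_weight ha (hgi 1)).mono_set hRQ)] at hlow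
  have h0 := hup 0
  have h1 := hup 1
  have hΛ0 : 0 ≤ Λ := Real.log_nonneg (by rw [le_div_iff₀ ha]; linarith)
  have hE0 : 0 ≤ E / a := div_nonneg (integral_nonneg hq0) ha.le
  have hX : 0 ≤ 60 / M * ((C + 1) * Λ + E / a) := by positivity
  have hY : 0 ≤ d / 104 * (60 / M) * Λ := by positivity
  have e1 : 360 / M * ((C + 1) * Λ + E / a) = 6 * (60 / M * ((C + 1) * Λ + E / a)) := by ring
  rw [e1]
  linarith

theorem linearEnergy_lower_bound {𝒦 : Set Mat2} (hK : IsCompact 𝒦) {d : ℝ}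
    (hd : IsLeast ((fun K : Mat2 => |K 1 1|) '' 𝒦) d) (hd0 : 0 < d) :
    ∃ c : ℝ, 0 < c ∧
      ∀ (u : ℝ × ℝ → Vec2) (T : ℝ → Vec2), MemW12 u → IsLeftTrace u T →
        (∀ a b : ℝ, 0 ≤ a → a < b → b ≤ 1 →
          essOsc T (Ioo a b) ≤ ENNReal.ofReal (d / 104 * (b - a))) →
        ∀ ε : ℝ, 0 < ε →
          ENNReal.ofReal (c * min 1 (ε * (|Real.log ε| + 1))) ≤ linearEnergy 𝒦 ε u := by
  have hne : 𝒦.Nonempty := hd.1.imp fun _ h => h.1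
  have hdK : ∀ K ∈ 𝒦, d ≤ |K 1 1| := fun K hKm => hd.2 ⟨K, hKm, rfl⟩
  obtain ⟨C, hC0, hC⟩ := exists_bound_entries hK
  obtain ⟨c, hc, hmain⟩ := exists_scaling_constant hd0 (by linarith : 0 ≤ C + 1)
  refine ⟨c, hc, fun u T hu hT hosc ε hε => ?_⟩
  have hGm := hu.isL2WeakGradient.memLp
  have hstrain : ∀ x i j, strain u x i j = 1 / 2 * (weakGrad u x i j + weakGrad u x j i) :=
    fun x i j => by simp [strain]
  have hSm : ∀ i j, MemLp (fun x => strain u x i j) 2 (volume.restrict unitSquare) := fun i j => by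
    simp_rw [hstrain]
    exact ((hGm i j).add (hGm j i)).const_mul _
  refine ofReal_le_energy hε
    ((aestronglyMeasurable_distWells (fun i j => (hSm i j).1) 𝒦).pow 2)
    (fun x => sq_nonneg _) fun hq hTV => ?_
  set q : ℝ × ℝ → ℝ := fun x => distWells (strain u x) 𝒦 ^ 2 with hqdef
  have hq0 : ∀ x, 0 ≤ q x := fun x => sq_nonneg _
  refine hmain _ _ (integral_nonneg hq0) ENNReal.toReal_nonneg (fun M a s₀ h has => ?_) ε hε
  have hM : 0 < M := by linarith [h.one_le]
  have ha := h.pos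
  set Λ : ℝ := Real.log ((1 + a) / a) with hΛ
  set E : ℝ := ∫ x in unitSquare, q x with hE
  set V : ℝ := (totalVar (weakGrad u)).toReal with hV
  have hlip : ∀ i, LipschitzByDuality (d / 104) fun y => T y i :=
    lipschitzByDuality_of_essOsc_le hosc (by positivity)
  have hdiag : ∀ x i, strain u x i i = weakGrad u x i i := fun x i => by rw [hstrain]; ring
  have hoff := integral_abs_mul_weight_le ha (C := 2 * (C + 1)) (q := fun x => 2 * q x)
    (g := fun x => weakGrad u x 1 0 + weakGrad u x 0 1)
    (fun x => mul_nonneg zero_le_two (hq0 x)) (hq.const_mul 2) ((hGm 1 0).add (hGm 0 1))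
    fun x => by
      have h1 := abs_entry_le hK hne hC (strain u x) 1 0
      have h2 : weakGrad u x 1 0 + weakGrad u x 0 1 = 2 * strain u x 1 0 := by rw [hstrain]; ring
      rw [h2, abs_mul, abs_two]
      linarith
  rw [integral_const_mul] at hoff
  have hnn := integral_abs_mul_weight_le ha hq0 hq (hGm 0 0) fun x => by
    have h1 := abs_entry_le hK hne hC (strain u x) 0 0
    rwa [hdiag] at h1
  have hup := h.integral_rectangle_le (hGm 1 1) fun σ hσ =>
    hσ.integral_mul_le_of_strain (V := V) h (hT.hasTracedGradient hu 1) (hT.hasTracedGradient hu 0)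
      (by positivity) (hlip 1) (hlip 0) fun Φ h2 h3 h4 h5 =>
      integral_mul_partialD_le_totalVar hTV hM 1 h2 h3 h4 h5
  have hlow := le_integral_mul_weight (b := s₀ / 2) (c := 1 / d) ha has
    (by linarith [h.s₀_lt, h.s₀_pos]) (by positivity) hq0 hq
    (((hGm 1 1).integrable (by norm_num)).abs)
    fun x => by
      have := le_abs_diag_add hK hne hd0 hdK (strain u x)
      rwa [hdiag] at this
  have hΛ0 : 0 ≤ Λ := Real.log_nonneg (by rw [le_div_iff₀ ha]; linarith)
  have hE0 : 0 ≤ E / a := div_nonneg (integral_nonneg hq0) ha.le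
  have hMV : 0 ≤ M * V := mul_nonneg hM.le ENNReal.toReal_nonneg
  have hX : 0 ≤ 60 / M * ((C + 1) * Λ + E / a) := by positivity
  have hY : 0 ≤ d / 104 * (1 + 60 / M) * Λ := by positivity
  have h60 : 0 ≤ 60 / M := by positivity
  have hoff' := mul_le_mul_of_nonneg_left hoff h60
  have hnn' := mul_le_mul_of_nonneg_left hnn h60
  have e1 : 360 / M * ((C + 1) * Λ + E / a) = 6 * (60 / M * ((C + 1) * Λ + E / a)) := by ring
  have e2 : 60 / M * (2 * (C + 1) * Λ + 2 * E / a) = 2 * (60 / M * ((C + 1) * Λ + E / a)) := by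
    ring
  rw [e2] at hoff'
  rw [e1]
  linarith

theorem mainTheorem5 :
    -- geometrically nonlinear setting
    (∀ 𝒦 : Set Mat2, IsCompact 𝒦 →
      ∀ d : ℝ, IsLeast ((fun K => ‖mulVec2 K e2 - e2‖) '' 𝒦) d → 0 < d →
      ∃ c : ℝ, 0 < c ∧
        ∀ (u : ℝ × ℝ → Vec2) (T : ℝ → Vec2), MemW12 u → IsLeftTrace u T →
          (∀ a b : ℝ, 0 ≤ a → a < b → b ≤ 1 →
            essOsc (fun y => T y - !₂[0, y]) (Ioo a b) ≤ ENNReal.ofReal (d / 104 * (b - a))) →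
          ∀ ε : ℝ, 0 < ε →
            ENNReal.ofReal (c * min 1 (ε * (|Real.log ε| + 1))) ≤ nonlinearEnergy 𝒦 ε u) ∧
    -- geometrically linear setting
    (∀ 𝒦 : Set Mat2, IsCompact 𝒦 → (∀ K ∈ 𝒦, K.IsSymm) →
      ∀ d : ℝ, IsLeast ((fun K : Mat2 => |K 1 1|) '' 𝒦) d → 0 < d →
      ∃ c : ℝ, 0 < c ∧
        ∀ (u : ℝ × ℝ → Vec2) (T : ℝ → Vec2), MemW12 u → IsLeftTrace u T →
          (∀ a b : ℝ, 0 ≤ a → a < b → b ≤ 1 →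
            essOsc T (Ioo a b) ≤ ENNReal.ofReal (d / 104 * (b - a))) →
          ∀ ε : ℝ, 0 < ε →
            ENNReal.ofReal (c * min 1 (ε * (|Real.log ε| + 1))) ≤ linearEnergy 𝒦 ε u) := by
  exact ⟨fun 𝒦 hK d hd hd0 => nonlinearEnergy_lower_bound hK hd hd0,
    fun 𝒦 hK _ d hd hd0 => linearEnergy_lower_bound hK hd hd0⟩
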